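/- Conventions. Let $d\ge 4$ be even. A quantum state is a positive semidefinite matrix of trace one; for $\rho\in M_d(\mathbb C)\otimes M_d(\mathbb C)$ let $\rho^\Gamma=(\mathrm{id}\otimes\top)(\rho)$ be its partial transpose, and call a state $\rho$ PPT if $\rho^\Gamma\ge 0$. The Schmidt number $\mathrm{SN}(\rho)$ is the least $k$ such that $\rho$ is a convex combination of pure states $|\xi\rangle\langle\xi|$ with $\|\xi\|=1$ and Schmidt rank of $\xi$ at most $k$. Two matrices $\rho,\sigma$ are local-unitary equivalent if $\sigma=(U\otimes W)\rho(U\otimes W)^*$ for some $U,W\in U(d)$. Let $\Omega=\begin{pmatrix}0&I_{d/2}\\-I_{d/2}&0\end{pmatrix}$, $Sp(d)=\{S\in U(d): S^\top\Omega S=\Omega\}$, and let $\mathrm{Inv}(S\otimes S)$ (resp. $\mathrm{Inv}(S\otimes\overline S)$) be the set of $X\in M_d(\mathbb C)\otimes M_d(\mathbb C)$ with $(S\otimes S)X(S\otimes S)^*=X$ (resp. $(S\otimes\overline S)X(S\otimes\overline S)^*=X$) for all $S\in Sp(d)$. With $|\omega\rangle=\frac1{\sqrt d}\sum_{j}|jj\rangle$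 and $F=\sum_{i,j}|ij\rangle\langle ji|$, put $$\rho_{a,b}=\frac{1-a-b}{d^2}I\otimes I+a|\omega\rangle\langle\omega|+\frac bd(I\otimes\Omega)F(I\otimes\Omega)^*,\qquad a,b\in\mathbb R.$$ Corollary. Let $d\ge4$ be even. 1. In each of the classes $\mathrm{Inv}(S\otimes\overline S)$ and $\mathrm{Inv}(S\otimes S)$ there is a PPT state $\rho$ with $\mathrm{SN}(\rho)-\mathrm{SN}(\rho^\Gamma)=\frac d2-2$. Explicitly, $\rho=\rho_{\frac1{2d-2},\frac{2d-3}{2d^2-2}}$ lies in $\mathrm{Inv}(S\otimes\overline S)$, is a PPT state, and has $\mathrm{SN}(\rho)=\frac d2$, $\mathrm{SN}(\rho^\Gamma)=2$. 2. In each of the classes $\mathrm{Inv}(S\otimes\overline S)$ and $\mathrm{Inv}(S\otimes S)$ there is a state $\rho$ that is local-unitary equivalent to $\rho^\Gamma$ and has $\mathrm{SN}(\rho)=\frac d2$. Explicitly, for every real $a$ with $\frac{d-3}{d^2-d-2}<a\le\frac1{d+2}$, the matrix $\rho_{a,a}$ is a state in $\mathrm{Inv}(S\otimes\overline S)$ that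 is local-unitary equivalent to $\rho_{a,a}^\Gamma$ and has $\mathrm{SN}(\rho_{a,a})=\frac d2$. -/

import Mathlib

open scoped ComplexOrder Kronecker

namespace SympState

noncomputable section

variable {m n : Type*} [Fintype m] [Fintype n]

/-- `ξ ∈ ℂᵐ ⊗ ℂⁿ` has a Schmidt decomposition `ξ = ∑ c_l v_l ⊗ w_l` with exactly `k` terms:
all `c_l > 0` and `(v_l)`, `(w_l)` orthonormal.  The number `k` is determined by `ξ`; it is the
Schmidt rank.  (The order of the `c_l` is immaterial.) -/
def HasSchmidtRank (ξ : EuclideanSpace ℂ (m × n)) (k : ℕ) : Prop :=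
  ∃ (c : Fin k → ℝ) (v : Fin k → EuclideanSpace ℂ m) (w : Fin k → EuclideanSpace ℂ n),
    (∀ l, 0 < c l) ∧ Orthonormal ℂ v ∧ Orthonormal ℂ w ∧
      ∀ i j, ξ (i, j) = ∑ l, (c l : ℂ) * v l i * w l j

/-- The rank-one operator `|ξ⟩⟨ξ|`. -/
def ketBra (ξ : EuclideanSpace ℂ n) : Matrix n n ℂ :=
  Matrix.of fun p q => ξ p * star (ξ q)

/-- `SN_k`: the convex hull of the pure states of Schmidt rank at most `k`. -/
def schmidtSet (m n : Type*) [Fintype m] [Fintype n] (k : ℕ) :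
    Set (Matrix (m × n) (m × n) ℂ) :=
  convexHull ℝ {ρ | ∃ ξ : EuclideanSpace ℂ (m × n),
    ‖ξ‖ = 1 ∧ (∃ r ≤ k, HasSchmidtRank ξ r) ∧ ρ = ketBra ξ}

/-- The Schmidt number: the least `k` with `ρ ∈ SN_k` (such a `k` exists for every state). -/
def schmidtNumber (ρ : Matrix (m × n) (m × n) ℂ) : ℕ :=
  sInf {k : ℕ | ρ ∈ schmidtSet m n k}

/-- Quantum states: positive semidefinite matrices of trace one. -/
def IsState (ρ : Matrix n n ℂ) : Prop :=
  ρ.PosSemidef ∧ ρ.trace = 1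

/-- The partial transpose `ρ^Γ = (id ⊗ ⊤)(ρ)` on the second factor. -/
def partialTranspose (ρ : Matrix (m × n) (m × n) ℂ) : Matrix (m × n) (m × n) ℂ :=
  Matrix.of fun p q => ρ (p.1, q.2) (q.1, p.2)

/-- States with positive partial transpose. -/
def IsPPT (ρ : Matrix (m × n) (m × n) ℂ) : Prop :=
  IsState ρ ∧ (partialTranspose ρ).PosSemidef

/-- Local-unitary equivalence: `σ = (U ⊗ W) ρ (U ⊗ W)^*` for some unitary `U`, `W`. -/
def LocalUnitaryEquiv [DecidableEq m] [DecidableEq n]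
    (ρ σ : Matrix (m × n) (m × n) ℂ) : Prop :=
  ∃ U ∈ Matrix.unitaryGroup m ℂ, ∃ W ∈ Matrix.unitaryGroup n ℂ,
    σ = (U ⊗ₖ W) * ρ * (U ⊗ₖ W).conjTranspose

/-- `Ω_d`, with blocks `0, I; -I, 0` of size `d/2` (meaningful for even `d`). -/
def Omega (d : ℕ) : Matrix (Fin d) (Fin d) ℂ :=
  Matrix.of fun i j =>
    if (j : ℕ) = i + d / 2 then 1 else if (i : ℕ) = j + d / 2 then -1 else 0

/-- The compact symplectic group `Sp(d) = {S ∈ U(d) | Sᵀ Ω S = Ω}`, as a set of matrices. -/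
def Sp (d : ℕ) : Set (Matrix (Fin d) (Fin d) ℂ) :=
  {S | S ∈ Matrix.unitaryGroup (Fin d) ℂ ∧ S.transpose * Omega d * S = Omega d}

/-- `Inv(S ⊗ S)`. -/
def InvSS (d : ℕ) : Set (Matrix (Fin d × Fin d) (Fin d × Fin d) ℂ) :=
  {X | ∀ S ∈ Sp d, (S ⊗ₖ S) * X * (S ⊗ₖ S).conjTranspose = X}

/-- `Inv(S ⊗ S̄)`, where `S̄` is the entrywise complex conjugate. -/
def InvSSbar (d : ℕ) : Set (Matrix (Fin d × Fin d) (Fin d × Fin d) ℂ) :=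
  {X | ∀ S ∈ Sp d, (S ⊗ₖ S.map star) * X * (S ⊗ₖ S.map star).conjTranspose = X}

/-- The maximally entangled vector `|ω⟩ = d^{-1/2} ∑ |jj⟩`. -/
def omegaVec (d : ℕ) : EuclideanSpace ℂ (Fin d × Fin d) :=
  WithLp.toLp 2 fun p => if p.1 = p.2 then ((1 / √(d : ℝ) : ℝ) : ℂ) else 0

/-- The flip operator `F = ∑ |ij⟩⟨ji|`. -/
def flipOp (d : ℕ) : Matrix (Fin d × Fin d) (Fin d × Fin d) ℂ :=
  Matrix.of fun p q => if p.1 = q.2 ∧ p.2 = q.1 then 1 else 0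

/-- `ρ_{a,b} = (1-a-b)/d² I⊗I + a |ω⟩⟨ω| + (b/d) (I⊗Ω) F (I⊗Ω)^*`. -/
def rho (d : ℕ) (a b : ℝ) : Matrix (Fin d × Fin d) (Fin d × Fin d) ℂ :=
  (((1 - a - b) / (d : ℝ) ^ 2 : ℝ) : ℂ) • 1
    + (a : ℂ) • ketBra (omegaVec d)
    + ((b / (d : ℝ) : ℝ) : ℂ) •
      (((1 : Matrix (Fin d) (Fin d) ℂ) ⊗ₖ Omega d) * flipOp d *
        ((1 : Matrix (Fin d) (Fin d) ℂ) ⊗ₖ Omega d).conjTranspose)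

end

end SympState

open SympState

open SympState

/-! Everything is decided by two expectations of a state: its value on the flip $F$ and its value on
the unnormalised projection onto $\sum\Omega_{ij}|ij\rangle$ (`flipVal` and `omegaVal`). Conjugation
by $I\otimes\Omega$ intertwines $S\otimes S$ with $S\otimes\overline S$ on $Sp(d)$ and carries the
family `sig` to `rho`. Partial transposition sends `rho d a b` to `sig d b a`. Up to a local
unitary, partial transposition therefore exchanges $a$ and $b$, and it suffices to compute Schmidt
numbers of `sig`.

Lower bound (`omegaVal_ketBra_le`). If $\xi$ has coefficient matrix $X$ of rank at most $k$, then
$X-X^\top$ has rank at most $2k$. The inequality $|\mathrm{tr}\,B|^2\le \mathrm{rank}(B)\,\|B\|^2$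
for $B=(X-X^\top)\Omega^\top$ reads `omegaVal ≤ k * (1 - flipVal)`. It is linear in the state, so it
passes to the convex hull.

Upper bound (`sig_mem_schmidtSet`). Twirling a pure state over $Sp(d)$ stays in its Schmidt class,
preserves both expectations, and lands in the Hermitian commutant of $S\otimes S$. That commutant is
spanned by $I$, $F$ and `omegaOp` (`exists_eq_of_mem_InvSS`), so for $d>2$ the result is the member
of the family with the given expectations. In place of Haar measure, the twirl is the point of least
Frobenius norm in the convex hull of the orbit.

The vectors `pairVec` have Schmidt rank $k\le d/2$ and saturate the witness, so family members on
the line `omegaVal = k * (1 - flipVal)` with `flipVal < 1` have Schmidt number exactly $k$. The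
parameters of the gap example put `sig d a b` on the line for $k=d/2$ and `sig d b a` on the line
for $k=2$. For $a=b$ the two expectations coincide; the endpoint $a=1/(d+2)$ lies on the line for
$d/2$, and convexity with a separable point covers the interval. Positivity, including that of
partial transposes, comes for free from membership in a Schmidt class. -/

/-! ### Compact convex hulls and fixed points of unitary conjugation -/

/-- By Carathéodory, $\dim E+1$ points suffice for each convex combination, so the hull is a
continuous image of a simplex times a power of $s$. -/
theorem isCompact_convexHull_of_isCompact {E : Type*} [AddCommGroup E] [Module ℝ E]
    [FiniteDimensional ℝ E] [TopologicalSpace E] [ContinuousAdd E] [ContinuousSMul ℝ E]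
    {s : Set E} (hs : IsCompact s) : IsCompact (convexHull ℝ s) := by
  set N := Module.finrank ℝ E + 1
  let f : (Fin N → ℝ) × (Fin N → E) → E := fun p => ∑ i, p.1 i • p.2 i
  have hf : Continuous f := by fun_prop
  have hK : IsCompact (f '' (stdSimplex ℝ (Fin N) ×ˢ Set.pi Set.univ fun _ => s)) :=
    ((isCompact_stdSimplex ℝ (Fin N)).prod (isCompact_univ_pi fun _ => hs)).image hf
  convert hK
  apply Set.Subset.antisymm
  · intro x hx
    rw [convexHull_eq_union] at hx
    simp only [Set.mem_iUnion] at hx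
    obtain ⟨t, hts, hind, hxt⟩ := hx
    have hne : t.Nonempty := by
      rw [← Finset.coe_nonempty, ← convexHull_nonempty_iff (𝕜 := ℝ)]
      exact ⟨x, hxt⟩
    have hcard : t.card ≤ N := by
      have h1 := hind.card_le_finrank_succ
      rw [Fintype.card_coe] at h1
      exact h1.trans (Nat.succ_le_succ (Submodule.finrank_le _))
    have : Nonempty t := hne.to_subtype
    -- Carathéodory may give fewer than $N$ points; a surjection from `Fin N` pads the list by
    -- repetition.
    obtain ⟨g, hg⟩ : ∃ g : Fin N → t, Function.Surjective g := by
      obtain ⟨e⟩ := Function.Embedding.nonempty_of_card_le (α := t) (β := Fin N) (by simpa using hcard)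
      exact ⟨Function.invFun e, Function.invFun_surjective e.injective⟩
    let l : (Fin N → ℝ) →ₗ[ℝ] E := Fintype.linearCombination ℝ fun i => (g i : E)
    have hr : (t : Set E) ⊆ l '' Set.range fun i j : Fin N => if i = j then (1 : ℝ) else 0 := by
      intro y hy
      obtain ⟨i, hi⟩ := hg ⟨y, hy⟩
      exact ⟨_, ⟨i, rfl⟩, by simp [l, Fintype.linearCombination_apply, hi]⟩
    have h2 := convexHull_mono (𝕜 := ℝ) hr hxt
    rw [← l.image_convexHull, convexHull_basis_eq_stdSimplex] at h2
    obtain ⟨w, hw, rfl⟩ := h2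
    exact ⟨(w, fun i => g i), ⟨hw, fun i _ => hts (g i).2⟩, rfl⟩
  · rintro _ ⟨⟨w, g⟩, ⟨hw, hg⟩, rfl⟩
    exact (convex_convexHull ℝ s).sum_mem (fun i _ => hw.1 i) hw.2
      fun i _ => subset_convexHull ℝ s (hg i trivial)

namespace SympState

variable {ι : Type*} [Fintype ι] [DecidableEq ι]

/-- The squared Frobenius norm of a matrix. -/
noncomputable def frobSq (X : Matrix ι ι ℂ) : ℝ := ∑ i, ∑ j, Complex.normSq (X i j)

omit [DecidableEq ι] in
theorem frobSq_eq_trace (X : Matrix ι ι ℂ) : (frobSq X : ℂ) = (X.conjTranspose * X).trace := by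
  simp only [frobSq, Matrix.trace, Matrix.diag, Matrix.mul_apply, Matrix.conjTranspose_apply]
  rw [Finset.sum_comm]
  push_cast
  refine Finset.sum_congr rfl fun i _ => Finset.sum_congr rfl fun j _ => ?_
  rw [Complex.normSq_eq_conj_mul_self]; rfl

theorem frobSq_conj {U : Matrix ι ι ℂ} (hU : U.conjTranspose * U = 1) (X : Matrix ι ι ℂ) :
    frobSq (U * X * U.conjTranspose) = frobSq X := by
  have h : ((frobSq (U * X * U.conjTranspose) : ℝ) : ℂ) = frobSq X := by
    rw [frobSq_eq_trace, frobSq_eq_trace]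
    simp only [Matrix.conjTranspose_mul, Matrix.conjTranspose_conjTranspose]
    rw [Matrix.trace_mul_comm]
    simp only [Matrix.mul_assoc]
    rw [← Matrix.mul_assoc U.conjTranspose U, hU, Matrix.one_mul, Matrix.trace_mul_comm]
    simp only [Matrix.mul_assoc]
    rw [hU, Matrix.mul_one, Matrix.trace_mul_comm X]
  exact_mod_cast h

omit [DecidableEq ι] in
-- Strict convexity of the Hilbert norm: by the parallelogram law the midpoint of two distinct
-- matrices of equal norm is strictly shorter.
theorem eq_of_frobSq_le {X Y : Matrix ι ι ℂ} (h1 : frobSq X = frobSq Y)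
    (h2 : frobSq X ≤ frobSq ((1 / 2 : ℝ) • X + (1 / 2 : ℝ) • Y)) : X = Y := by
  have h3 : frobSq ((1 / 2 : ℝ) • X + (1 / 2 : ℝ) • Y) + (1 / 4) * frobSq (X - Y)
      = (1 / 2) * frobSq X + (1 / 2) * frobSq Y := by
    simp only [frobSq, Finset.mul_sum, ← Finset.sum_add_distrib]
    refine Finset.sum_congr rfl fun i _ => Finset.sum_congr rfl fun j _ => ?_
    simp only [Complex.normSq_apply, Matrix.add_apply, Matrix.sub_apply, Matrix.smul_apply,
      Complex.add_re, Complex.add_im, Complex.sub_re, Complex.sub_im, Complex.smul_re,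
      Complex.smul_im, smul_eq_mul]
    ring
  have h4 : frobSq (X - Y) = 0 := by
    have : 0 ≤ frobSq (X - Y) :=
      Finset.sum_nonneg fun i _ => Finset.sum_nonneg fun j _ => Complex.normSq_nonneg _
    linarith
  ext i j
  have h5 := (Finset.sum_eq_zero_iff_of_nonneg
    (fun i _ => Finset.sum_nonneg fun j _ => Complex.normSq_nonneg _)).1 h4 i (Finset.mem_univ _)
  have h6 := (Finset.sum_eq_zero_iff_of_nonneg
    (fun j _ => Complex.normSq_nonneg _)).1 h5 j (Finset.mem_univ _)
  exact sub_eq_zero.1 (Complex.normSq_eq_zero.1 h6)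

/-- A compact set of matrices stable under conjugation by a set of unitaries has a fixed point in
its convex hull. -/
theorem exists_invariant_mem_convexHull {K : Set (Matrix ι ι ℂ)} (hK : IsCompact K)
    (hne : K.Nonempty) {G : Set (Matrix ι ι ℂ)} (hG : ∀ U ∈ G, U.conjTranspose * U = 1)
    (hGK : ∀ U ∈ G, ∀ X ∈ K, U * X * U.conjTranspose ∈ K) :
    ∃ R ∈ convexHull ℝ K, ∀ U ∈ G, U * R * U.conjTranspose = R := by
  have hc : Continuous (frobSq : Matrix ι ι ℂ → ℝ) := by
    unfold frobSq
    refine continuous_finsetSum _ fun i _ => continuous_finsetSum _ fun j _ =>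
      Complex.continuous_normSq.comp (continuous_id.matrix_elem i j)
  -- The minimiser of the norm on the hull is the fixed point: its conjugates lie in the hull with
  -- the same norm, and minimality at the midpoint forces them to coincide with it.
  obtain ⟨R, hR, hmin⟩ := (isCompact_convexHull_of_isCompact hK).exists_isMinOn
    (hne.convexHull (𝕜 := ℝ)) hc.continuousOn
  refine ⟨R, hR, fun U hU => ?_⟩
  have hUR : U * R * U.conjTranspose ∈ convexHull ℝ K := by
    let l : Matrix ι ι ℂ →ₗ[ℝ] Matrix ι ι ℂ :=
      { toFun := fun X => U * X * U.conjTranspose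
        map_add' := fun X Y => by rw [Matrix.mul_add, Matrix.add_mul]
        map_smul' := fun r X => by simp }
    have h1 : l '' K ⊆ K := by rintro _ ⟨X, hX, rfl⟩; exact hGK U hU X hX
    have h2 := convexHull_mono (𝕜 := ℝ) h1
    rw [← l.image_convexHull] at h2
    exact h2 ⟨R, hR, rfl⟩
  refine eq_of_frobSq_le (frobSq_conj (hG U hU) R) ?_
  rw [frobSq_conj (hG U hU) R]
  exact hmin ((convex_convexHull ℝ K) hUR hR (by norm_num) (by norm_num) (by norm_num))

/-! ### Local unitaries preserve Schmidt classes -/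

section LocalUnitary

variable {m n : Type*} [Fintype m] [Fintype n] [DecidableEq m] [DecidableEq n]

theorem inner_toLp_mulVec {U : Matrix m m ℂ} (hU : U ∈ Matrix.unitaryGroup m ℂ)
    (x y : EuclideanSpace ℂ m) :
    inner ℂ (WithLp.toLp 2 (U.mulVec x.ofLp) : EuclideanSpace ℂ m)
      (WithLp.toLp 2 (U.mulVec y.ofLp)) = inner ℂ x y := by
  have h : U.conjTranspose * U = 1 := (Matrix.mem_unitaryGroup_iff').1 hU
  rw [EuclideanSpace.inner_eq_star_dotProduct, EuclideanSpace.inner_eq_star_dotProduct,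
    Matrix.star_mulVec, dotProduct_comm, Matrix.dotProduct_mulVec, Matrix.vecMul_vecMul, h,
    Matrix.vecMul_one, dotProduct_comm]

theorem orthonormal_toLp_mulVec {U : Matrix m m ℂ} (hU : U ∈ Matrix.unitaryGroup m ℂ)
    {κ : Type*} {v : κ → EuclideanSpace ℂ m} (hv : Orthonormal ℂ v) :
    Orthonormal ℂ fun l => (WithLp.toLp 2 (U.mulVec (v l).ofLp) : EuclideanSpace ℂ m) := by
  classical
  rw [orthonormal_iff_ite] at hv ⊢
  intro i j
  rw [inner_toLp_mulVec hU, hv]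

theorem kronecker_mem_unitaryGroup {U : Matrix m m ℂ} {W : Matrix n n ℂ}
    (hU : U ∈ Matrix.unitaryGroup m ℂ) (hW : W ∈ Matrix.unitaryGroup n ℂ) :
    U ⊗ₖ W ∈ Matrix.unitaryGroup (m × n) ℂ := Matrix.kronecker_mem_unitary hU hW

theorem HasSchmidtRank.kronecker_mulVec {U : Matrix m m ℂ} {W : Matrix n n ℂ}
    (hU : U ∈ Matrix.unitaryGroup m ℂ) (hW : W ∈ Matrix.unitaryGroup n ℂ)
    {ξ : EuclideanSpace ℂ (m × n)} {k : ℕ} (h : HasSchmidtRank ξ k) :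
    HasSchmidtRank (WithLp.toLp 2 ((U ⊗ₖ W).mulVec ξ.ofLp) : EuclideanSpace ℂ (m × n)) k := by
  obtain ⟨c, v, w, hc, hv, hw, h⟩ := h
  refine ⟨c, _, _, hc, orthonormal_toLp_mulVec hU hv, orthonormal_toLp_mulVec hW hw,
    fun i j => ?_⟩
  simp only [Matrix.mulVec, dotProduct, Fintype.sum_prod_type, h, Matrix.kroneckerMap_apply,
    Finset.mul_sum, Finset.sum_mul]
  simp_rw [fun a : m => Finset.sum_comm (s := (Finset.univ : Finset n)) (t := Finset.univ)
    (f := fun b l => U i a * W j b * (((c l : ℂ)) * (v l).ofLp a * (w l).ofLp b))]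
  rw [Finset.sum_comm]
  refine Finset.sum_congr rfl fun l _ => ?_
  rw [Finset.sum_comm]
  refine Finset.sum_congr rfl fun b _ => Finset.sum_congr rfl fun a _ => ?_
  ring

omit [DecidableEq m] in
theorem ketBra_mulVec (A : Matrix m m ℂ) (ξ : EuclideanSpace ℂ m) :
    ketBra (WithLp.toLp 2 (A.mulVec ξ.ofLp) : EuclideanSpace ℂ m)
      = A * ketBra ξ * A.conjTranspose := by
  have h (η : EuclideanSpace ℂ m) : ketBra η = Matrix.vecMulVec η.ofLp (star η.ofLp) := rfl
  rw [h, h, Matrix.star_mulVec, Matrix.mul_vecMulVec, Matrix.vecMulVec_mul]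

/-- Conjugation by a matrix, as a real-linear map. -/
noncomputable def conjMap (A : Matrix m m ℂ) : Matrix m m ℂ →ₗ[ℝ] Matrix m m ℂ where
  toFun X := A * X * A.conjTranspose
  map_add' X Y := by rw [Matrix.mul_add, Matrix.add_mul]
  map_smul' r X := by simp

theorem conj_mem_schmidtSet {U : Matrix m m ℂ} {W : Matrix n n ℂ}
    (hU : U ∈ Matrix.unitaryGroup m ℂ) (hW : W ∈ Matrix.unitaryGroup n ℂ) {k : ℕ}
    {ρ : Matrix (m × n) (m × n) ℂ} (h : ρ ∈ schmidtSet m n k) :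
    (U ⊗ₖ W) * ρ * (U ⊗ₖ W).conjTranspose ∈ schmidtSet m n k := by
  have h1 : conjMap (U ⊗ₖ W) ρ ∈ conjMap (U ⊗ₖ W) '' schmidtSet m n k := ⟨ρ, h, rfl⟩
  rw [schmidtSet, LinearMap.image_convexHull] at h1
  refine convexHull_mono ?_ h1
  rintro _ ⟨_, ⟨ξ, hξ, ⟨r, hr, hξr⟩, rfl⟩, rfl⟩
  refine ⟨_, ?_, ⟨r, hr, hξr.kronecker_mulVec hU hW⟩, (ketBra_mulVec _ _).symm⟩
  have h2 := inner_toLp_mulVec (kronecker_mem_unitaryGroup hU hW) ξ ξ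
  rw [inner_self_eq_norm_sq_to_K, inner_self_eq_norm_sq_to_K, hξ] at h2
  have h3 : ‖(WithLp.toLp 2 ((U ⊗ₖ W).mulVec ξ.ofLp) : EuclideanSpace ℂ (m × n))‖ ^ 2 = 1 := by
    have : (((‖(WithLp.toLp 2 ((U ⊗ₖ W).mulVec ξ.ofLp) : EuclideanSpace ℂ (m × n))‖ ^ 2 : ℝ)) : ℂ)
        = ((1 : ℝ) : ℂ) := by push_cast; simpa using h2
    exact_mod_cast this
  exact (pow_eq_one_iff_of_nonneg (norm_nonneg _) two_ne_zero).1 h3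

theorem schmidtNumber_conj {U : Matrix m m ℂ} {W : Matrix n n ℂ}
    (hU : U ∈ Matrix.unitaryGroup m ℂ) (hW : W ∈ Matrix.unitaryGroup n ℂ)
    (ρ : Matrix (m × n) (m × n) ℂ) :
    schmidtNumber ((U ⊗ₖ W) * ρ * (U ⊗ₖ W).conjTranspose) = schmidtNumber ρ := by
  unfold schmidtNumber
  congr 1
  ext k
  refine ⟨fun h => ?_, conj_mem_schmidtSet hU hW⟩
  have h1 : (U ⊗ₖ W).conjTranspose * (U ⊗ₖ W) = 1 :=
    Matrix.mem_unitaryGroup_iff'.1 (kronecker_mem_unitaryGroup hU hW)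
  -- The converse inclusion is the direct one applied to the inverse local unitary.
  have h2 := conj_mem_schmidtSet (Unitary.star_mem hU) (Unitary.star_mem hW) h
  rw [Matrix.star_eq_conjTranspose, Matrix.star_eq_conjTranspose, ← Matrix.conjTranspose_kronecker,
    Matrix.conjTranspose_conjTranspose] at h2
  simp only [Matrix.mul_assoc] at h2
  rwa [h1, Matrix.mul_one, ← Matrix.mul_assoc, h1, Matrix.one_mul] at h2

end LocalUnitary

/-! ### Pure states and the rank bound on the trace -/

variable {m n : Type*} [Fintype m] [Fintype n]

theorem trace_ketBra (ξ : EuclideanSpace ℂ m) : (ketBra ξ).trace = ((‖ξ‖ ^ 2 : ℝ) : ℂ) := by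
  rw [EuclideanSpace.norm_sq_eq]
  simp only [Matrix.trace, Matrix.diag, ketBra, Matrix.of_apply]
  push_cast
  exact Finset.sum_congr rfl fun i _ => Complex.mul_conj' _

theorem convex_isState : Convex ℝ {ρ : Matrix m m ℂ | IsState ρ} := by
  rintro ρ ⟨h1, h2⟩ σ ⟨h3, h4⟩ a b ha hb hab
  refine ⟨(h1.smul ha).add (h3.smul hb), ?_⟩
  rw [Matrix.trace_add, Matrix.trace_smul, Matrix.trace_smul, h2, h4, ← add_smul, hab, one_smul]

theorem isState_ketBra {ξ : EuclideanSpace ℂ m} (hξ : ‖ξ‖ = 1) : IsState (ketBra ξ) := by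
  refine ⟨Matrix.posSemidef_vecMulVec_self_star ξ.ofLp, ?_⟩
  rw [trace_ketBra, hξ]; simp

/-- The only source of positivity in the argument: a partial transpose is shown to be positive by
placing it in a Schmidt class. -/
theorem isState_of_mem_schmidtSet {k : ℕ} {ρ : Matrix (m × n) (m × n) ℂ}
    (h : ρ ∈ schmidtSet m n k) : IsState ρ := by
  refine convexHull_min ?_ convex_isState h
  rintro _ ⟨ξ, hξ, -, rfl⟩
  exact isState_ketBra hξ

/-- `|tr B|² ≤ r ‖B‖²` for a matrix `B` that factors through `ℂ^r`. -/
theorem normSq_trace_mul_le {ι κ : Type*} [Fintype ι] [DecidableEq ι] [Fintype κ]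
    (F : Matrix ι κ ℂ) (G : Matrix κ ι ℂ) :
    Complex.normSq (F * G).trace ≤ Fintype.card κ * frobSq (F * G) := by
  set B := F * G
  have hH := Matrix.isHermitian_conjTranspose_mul_self B
  set U : Matrix ι ι ℂ := (hH.eigenvectorUnitary : Matrix ι ι ℂ)
  have hU1 : U.conjTranspose * U = 1 := Matrix.mem_unitaryGroup_iff'.1 hH.eigenvectorUnitary.2
  have hU2 : U * U.conjTranspose = 1 := Matrix.mem_unitaryGroup_iff.1 hH.eigenvectorUnitary.2
  -- In an eigenbasis of $B^*B$ the columns of $C$ are orthogonal, with squared lengths the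
  -- eigenvalues; trace and Frobenius norm are unchanged.
  set C := U.conjTranspose * B * U
  have htr : C.trace = B.trace := by
    rw [Matrix.trace_mul_comm, ← Matrix.mul_assoc, hU2, Matrix.one_mul]
  have hfr : frobSq C = frobSq B := by
    have := frobSq_conj (U := U.conjTranspose) (by rwa [Matrix.conjTranspose_conjTranspose]) B
    rwa [Matrix.conjTranspose_conjTranspose] at this
  have hdiag : C.conjTranspose * C = Matrix.diagonal fun i => (hH.eigenvalues i : ℂ) := by
    have h := hH.conjStarAlgAut_star_eigenvectorUnitary
    rw [Unitary.conjStarAlgAut_star_apply] at h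
    have h2 : C.conjTranspose * C = U.conjTranspose * (B.conjTranspose * B) * U := by
      simp only [C, Matrix.conjTranspose_mul, Matrix.conjTranspose_conjTranspose, Matrix.mul_assoc]
      rw [← Matrix.mul_assoc U, hU2, Matrix.one_mul]
    rw [h2]
    exact h
  have hcol (i : ι) : ∑ j, Complex.normSq (C j i) = hH.eigenvalues i := by
    have h := congrFun (congrFun hdiag i) i
    rw [Matrix.diagonal_apply_eq, Matrix.mul_apply] at h
    have h3 : ((∑ j, Complex.normSq (C j i) : ℝ) : ℂ) = hH.eigenvalues i := by
      rw [← h]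
      push_cast
      exact Finset.sum_congr rfl fun j _ => by rw [Complex.normSq_eq_conj_mul_self]; rfl
    exact_mod_cast h3
  have hle (i : ι) : Complex.normSq (C i i) ≤ hH.eigenvalues i := by
    rw [← hcol i]
    exact Finset.single_le_sum (f := fun j => Complex.normSq (C j i))
      (fun j _ => Complex.normSq_nonneg _) (Finset.mem_univ i)
  -- Only as many columns of $C$ as the rank of $B$ are nonzero. The trace has at most that many
  -- nonzero terms, and Cauchy–Schwarz on them gives the bound.
  set T := Finset.univ.filter fun i => hH.eigenvalues i ≠ 0
  have hT : T.card ≤ Fintype.card κ := by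
    have h1 : T.card = Matrix.rank B := by
      rw [← Matrix.rank_conjTranspose_mul_self B, hH.rank_eq_card_non_zero_eigs,
        Fintype.card_subtype]
    rw [h1]
    exact (Matrix.rank_mul_le_left F G).trans (Matrix.rank_le_card_width F)
  have htT : C.trace = ∑ i ∈ T, C i i := by
    refine (Finset.sum_subset (Finset.subset_univ _) fun i _ hi => ?_).symm
    have h0 : hH.eigenvalues i = 0 := by simpa [T] using hi
    have h1 := hle i
    rw [h0] at h1
    exact Complex.normSq_eq_zero.1 (le_antisymm h1 (Complex.normSq_nonneg _))
  rw [← htr, htT, ← hfr, Complex.normSq_eq_norm_sq]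
  calc ‖∑ i ∈ T, C i i‖ ^ 2 ≤ (∑ i ∈ T, ‖C i i‖) ^ 2 := by
        gcongr; exact norm_sum_le _ _
    _ ≤ T.card * ∑ i ∈ T, ‖C i i‖ ^ 2 := sq_sum_le_card_mul_sum_sq
    _ ≤ Fintype.card κ * frobSq C := by
        gcongr
        rw [frobSq, Finset.sum_comm]
        calc ∑ i ∈ T, ‖C i i‖ ^ 2 ≤ ∑ i, ‖C i i‖ ^ 2 :=
              Finset.sum_le_sum_of_subset_of_nonneg (Finset.subset_univ _)
                fun _ _ _ => by positivity
          _ ≤ _ := Finset.sum_le_sum fun i _ => by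
              rw [hcol, ← Complex.normSq_eq_norm_sq]; exact hle i

/-! ### The symplectic form in coordinates -/

variable {d : ℕ}

/-- The involution exchanging `i` and `i + d / 2`. -/
def bar (i : Fin d) : Fin d :=
  if h : (i : ℕ) < d / 2 then ⟨i + d / 2, by omega⟩ else ⟨i - d / 2, by omega⟩

/-- The sign of the nonzero entry in row `i` of `Ω`. -/
def sgn (i : Fin d) : ℂ := if (i : ℕ) < d / 2 then 1 else -1

theorem bar_val (i : Fin d) :
    (bar i : ℕ) = if (i : ℕ) < d / 2 then (i : ℕ) + d / 2 else i - d / 2 := by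
  unfold bar; split_ifs <;> rfl

theorem bar_bar (hd : Even d) (i : Fin d) : bar (bar i) = i := by
  obtain ⟨n, rfl⟩ := hd
  have := i.2
  ext
  rw [bar_val, bar_val]
  split_ifs <;> omega

theorem bar_ne (hd : Even d) (i : Fin d) : bar i ≠ i := by
  obtain ⟨n, rfl⟩ := hd
  have := i.2
  intro h
  rw [Fin.ext_iff, bar_val] at h
  split_ifs at h <;> omega

theorem sgn_bar (hd : Even d) (i : Fin d) : sgn (bar i) = -sgn i := by
  obtain ⟨n, rfl⟩ := hd
  have := i.2
  unfold sgn
  rw [bar_val]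
  split_ifs with h1 h2 h2 <;> first | omega | simp

theorem sgn_mul_self (i : Fin d) : sgn i * sgn i = 1 := by
  unfold sgn; split_ifs <;> simp

theorem star_sgn (i : Fin d) : (starRingEnd ℂ) (sgn i) = sgn i := by
  unfold sgn; split_ifs <;> simp

theorem sgn_ne_zero (i : Fin d) : sgn i ≠ 0 := by
  unfold sgn; split_ifs <;> simp

theorem Omega_apply (hd : Even d) (i j : Fin d) :
    Omega d i j = if j = bar i then sgn i else 0 := by
  obtain ⟨n, rfl⟩ := hd
  have := i.2
  have := j.2
  unfold Omega sgn
  simp only [Matrix.of_apply, Fin.ext_iff, bar_val]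
  split_ifs with h1 h2 h3 h2 h3 h4 h5 <;> first | rfl | omega

theorem Omega_transpose (hd : Even d) : (Omega d).transpose = -Omega d := by
  ext i j
  rw [Matrix.transpose_apply, Matrix.neg_apply, Omega_apply hd, Omega_apply hd]
  by_cases h : j = bar i
  · rw [if_pos h, if_pos (by rw [h, bar_bar hd]), h, sgn_bar hd]
  · rw [if_neg h, if_neg (fun h' => h (by rw [h', bar_bar hd])), neg_zero]

theorem Omega_map_star (hd : Even d) : (Omega d).map star = Omega d := by
  ext i j
  rw [Matrix.map_apply, Omega_apply hd]
  split_ifs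
  · exact star_sgn i
  · exact star_zero _

theorem Omega_conjTranspose (hd : Even d) : (Omega d).conjTranspose = -Omega d := by
  rw [Matrix.conjTranspose, Omega_transpose hd]
  conv_rhs => rw [← Omega_map_star hd]
  ext i j
  simp only [Matrix.map_apply, Matrix.neg_apply, star_neg]

theorem Omega_mul_Omega (hd : Even d) : Omega d * Omega d = -1 := by
  ext i j
  simp only [Matrix.mul_apply, Omega_apply hd, ite_mul, zero_mul, Finset.sum_ite_eq',
    Finset.mem_univ, if_true, bar_bar hd, sgn_bar hd, Matrix.neg_apply, Matrix.one_apply]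
  by_cases h : i = j
  · subst h; simp [sgn_mul_self]
  · rw [if_neg (Ne.symm h), if_neg h]; simp

theorem Omega_mem_unitaryGroup (hd : Even d) : Omega d ∈ Matrix.unitaryGroup (Fin d) ℂ := by
  rw [Matrix.mem_unitaryGroup_iff, Matrix.star_eq_conjTranspose, Omega_conjTranspose hd,
    Matrix.mul_neg, Omega_mul_Omega hd, neg_neg]

/-! ### The two expectations and the Schmidt number witness -/

/-- The unnormalised projection onto the vector `∑ Ω_{ij} |ij⟩`. -/
noncomputable def omegaOp (d : ℕ) : Matrix (Fin d × Fin d) (Fin d × Fin d) ℂ :=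
  Matrix.of fun p q => Omega d p.1 p.2 * Omega d q.1 q.2

/-- The expectation of `omegaOp`. -/
noncomputable def omegaVal (ρ : Matrix (Fin d × Fin d) (Fin d × Fin d) ℂ) : ℝ :=
  (omegaOp d * ρ).trace.re

/-- The expectation of the flip. -/
noncomputable def flipVal (ρ : Matrix (Fin d × Fin d) (Fin d × Fin d) ℂ) : ℝ :=
  (flipOp d * ρ).trace.re

theorem omegaVal_lin (a b : ℝ) (ρ σ : Matrix (Fin d × Fin d) (Fin d × Fin d) ℂ) :
    omegaVal (a • ρ + b • σ) = a * omegaVal ρ + b * omegaVal σ := by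
  simp [omegaVal, Matrix.mul_add]

theorem flipVal_lin (a b : ℝ) (ρ σ : Matrix (Fin d × Fin d) (Fin d × Fin d) ℂ) :
    flipVal (a • ρ + b • σ) = a * flipVal ρ + b * flipVal σ := by
  simp [flipVal, Matrix.mul_add]

theorem flipOp_mul_apply (X : Matrix (Fin d × Fin d) (Fin d × Fin d) ℂ) (p q : Fin d × Fin d) :
    (flipOp d * X) p q = X p.swap q := by
  rw [Matrix.mul_apply, Finset.sum_eq_single p.swap]
  · simp [flipOp]
  · rintro ⟨a, b⟩ - h
    rw [flipOp, Matrix.of_apply, if_neg, zero_mul]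
    rintro ⟨h1, h2⟩
    exact h (Prod.ext h2.symm h1.symm)
  · simp

theorem omegaOp_mul_apply (X : Matrix (Fin d × Fin d) (Fin d × Fin d) ℂ) (p q : Fin d × Fin d) :
    (omegaOp d * X) p q = Omega d p.1 p.2 * ∑ r, Omega d r.1 r.2 * X r q := by
  simp only [Matrix.mul_apply, omegaOp, Matrix.of_apply, Finset.mul_sum, mul_assoc]

theorem star_Omega_apply (hd : Even d) (i j : Fin d) :
    (starRingEnd ℂ) (Omega d i j) = Omega d i j :=
  congrFun (congrFun (Omega_map_star hd) i) j

theorem Omega_apply_swap (hd : Even d) (i j : Fin d) : Omega d j i = -Omega d i j :=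
  congrFun (congrFun (Omega_transpose hd) i) j

theorem omegaVal_ketBra (hd : Even d) (ξ : EuclideanSpace ℂ (Fin d × Fin d)) :
    omegaVal (ketBra ξ) = Complex.normSq (∑ p, Omega d p.1 p.2 * ξ p) := by
  have h : (omegaOp d * ketBra ξ).trace
      = ((Complex.normSq (∑ p, Omega d p.1 p.2 * ξ p) : ℝ) : ℂ) := by
    rw [← Complex.mul_conj, map_sum, Matrix.trace, Finset.mul_sum]
    refine Finset.sum_congr rfl fun p _ => ?_
    rw [Matrix.diag_apply, omegaOp_mul_apply, map_mul, star_Omega_apply hd, Finset.mul_sum,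
      Finset.sum_mul]
    refine Finset.sum_congr rfl fun q _ => ?_
    simp only [ketBra, Matrix.of_apply, Complex.star_def]
    ring
  rw [omegaVal, h, Complex.ofReal_re]

theorem flipVal_ketBra (ξ : EuclideanSpace ℂ (Fin d × Fin d)) :
    flipVal (ketBra ξ) = ∑ p : Fin d × Fin d, (ξ p.swap * star (ξ p)).re := by
  simp [flipVal, Matrix.trace, flipOp_mul_apply, ketBra]

/-- Pure states of Schmidt rank at most `k` satisfy the witness inequality. -/
theorem omegaVal_ketBra_le (hd : Even d) {k r : ℕ} (hr : r ≤ k)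
    {ξ : EuclideanSpace ℂ (Fin d × Fin d)} (hξ : ‖ξ‖ = 1) (h : HasSchmidtRank ξ r) :
    omegaVal (ketBra ξ) ≤ k * (1 - flipVal (ketBra ξ)) := by
  obtain ⟨c, v, w, -, -, -, hvw⟩ := h
  let V : Matrix (Fin d) (Fin r) ℂ := Matrix.of fun i l => c l * v l i
  let C : Matrix (Fin r) (Fin d) ℂ := Matrix.of fun l j => w l j
  have hVC (i j : Fin d) : (V * C) i j = ξ (i, j) := by
    simp [hvw, V, C, Matrix.mul_apply]
  -- With $X=VC$ the coefficient matrix of $\xi$, this is $X-X^\top$ written as a product through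
  -- $\mathbb C^r\oplus\mathbb C^r$, which exhibits the rank bound $2r$.
  set A := Matrix.fromCols V C.transpose * Matrix.fromRows C (-V.transpose) with hA
  have hA' (i j : Fin d) : A i j = ξ (i, j) - ξ (j, i) := by
    rw [hA, Matrix.fromCols_mul_fromRows, Matrix.mul_neg, ← Matrix.transpose_mul,
      Matrix.add_apply, Matrix.neg_apply, Matrix.transpose_apply, hVC, hVC, sub_eq_add_neg]
  have hB := normSq_trace_mul_le (Matrix.fromCols V C.transpose)
    (Matrix.fromRows C (-V.transpose) * (Omega d).transpose)
  rw [← Matrix.mul_assoc, ← hA] at hB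
  have htr : (A * (Omega d).transpose).trace = 2 * ∑ p : Fin d × Fin d, Omega d p.1 p.2 * ξ p := by
    have h1 : ∑ p : Fin d × Fin d, Omega d p.1 p.2 * ξ p.swap
        = -∑ p : Fin d × Fin d, Omega d p.1 p.2 * ξ p := by
      rw [← (Equiv.prodComm (Fin d) (Fin d)).sum_comp, ← Finset.sum_neg_distrib]
      refine Finset.sum_congr rfl fun p _ => ?_
      simp [Omega_apply_swap hd p.1 p.2]
    have h2 : (A * (Omega d).transpose).trace
        = ∑ p : Fin d × Fin d, Omega d p.1 p.2 * (ξ p - ξ p.swap) := by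
      simp only [Matrix.trace, Matrix.diag, Matrix.mul_apply, Matrix.transpose_apply,
        Fintype.sum_prod_type, hA', Prod.swap, mul_comm]
    rw [h2]
    simp only [mul_sub, Finset.sum_sub_distrib, h1]
    ring
  -- $\Omega$ is unitary, and expanding $\|X-X^\top\|^2$ gives $2\|X\|^2$ minus twice the flip
  -- expectation.
  have hfr : frobSq (A * (Omega d).transpose) = 2 - 2 * flipVal (ketBra ξ) := by
    have h1 : frobSq (A * (Omega d).transpose) = frobSq A := by
      have h2 : ((frobSq (A * (Omega d).transpose) : ℝ) : ℂ) = frobSq A := by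
        rw [frobSq_eq_trace, frobSq_eq_trace, Matrix.conjTranspose_mul, Matrix.trace_mul_comm,
          Matrix.mul_assoc, ← Matrix.mul_assoc _ _ A.conjTranspose, Omega_transpose hd,
          Matrix.conjTranspose_neg, Omega_conjTranspose hd, neg_neg, Matrix.neg_mul,
          Omega_mul_Omega hd, neg_neg, Matrix.one_mul, Matrix.trace_mul_comm]
      exact_mod_cast h2
    have h3 : ∑ p, Complex.normSq (ξ p) = 1 := by
      have := EuclideanSpace.norm_sq_eq ξ
      rw [hξ] at this
      simp only [Complex.normSq_eq_norm_sq]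
      linarith
    have h4 : ∑ p : Fin d × Fin d, Complex.normSq (ξ p.swap) = 1 := by
      rw [← h3]
      exact (Equiv.prodComm (Fin d) (Fin d)).sum_comp fun p => Complex.normSq (ξ p)
    have h5 : frobSq A = ∑ p : Fin d × Fin d,
        (Complex.normSq (ξ p) + Complex.normSq (ξ p.swap) - 2 * (ξ p.swap * star (ξ p)).re) := by
      rw [frobSq, Fintype.sum_prod_type]
      refine Finset.sum_congr rfl fun i _ => Finset.sum_congr rfl fun j _ => ?_
      rw [hA']
      simp only [Complex.normSq_apply, Prod.swap, Complex.sub_re, Complex.sub_im, Complex.mul_re,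
        Complex.star_def, Complex.conj_re, Complex.conj_im]
      ring
    rw [h1, h5, Finset.sum_sub_distrib, Finset.sum_add_distrib, h3, h4, flipVal_ketBra,
      Finset.mul_sum]
    ring
  have hcard : (Fintype.card (Fin r ⊕ Fin r) : ℝ) ≤ 2 * k := by
    rw [Fintype.card_sum, Fintype.card_fin]; push_cast
    have : (r : ℝ) ≤ k := by exact_mod_cast hr
    linarith
  have hpos : 0 ≤ 2 - 2 * flipVal (ketBra ξ) := by
    rw [← hfr]
    exact Finset.sum_nonneg fun i _ => Finset.sum_nonneg fun j _ => Complex.normSq_nonneg _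
  rw [htr, hfr, Complex.normSq_mul, ← omegaVal_ketBra hd] at hB
  have h2 : Complex.normSq 2 = 4 := by norm_num [Complex.normSq_apply]
  rw [h2] at hB
  have := mul_le_mul_of_nonneg_right hcard hpos
  linarith

theorem omegaVal_le_of_mem_schmidtSet (hd : Even d) {k : ℕ}
    {ρ : Matrix (Fin d × Fin d) (Fin d × Fin d) ℂ} (h : ρ ∈ schmidtSet (Fin d) (Fin d) k) :
    omegaVal ρ ≤ k * (1 - flipVal ρ) := by
  have hc : Convex ℝ {ρ : Matrix (Fin d × Fin d) (Fin d × Fin d) ℂ |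
      omegaVal ρ ≤ k * (1 - flipVal ρ)} := by
    intro ρ hρ σ hσ a b ha hb hab
    simp only [Set.mem_ofPred_eq, omegaVal_lin, flipVal_lin] at *
    have h1 := mul_le_mul_of_nonneg_left hρ ha
    have h2 := mul_le_mul_of_nonneg_left hσ hb
    calc _ ≤ _ := add_le_add h1 h2
      _ = k * ((a + b) - (a * flipVal ρ + b * flipVal σ)) := by ring
      _ = _ := by rw [hab]
  refine convexHull_min ?_ hc h
  rintro _ ⟨ξ, hξ, ⟨r, hr, hξr⟩, rfl⟩
  exact omegaVal_ketBra_le hd hr hξ hξr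

/-- Since `flipVal ρ ≤ 1`, the witness bound is nondecreasing in the class index, so violating it at
$k-1$ excludes every smaller class. -/
theorem schmidtNumber_eq (hd : Even d) {k : ℕ} {ρ : Matrix (Fin d × Fin d) (Fin d × Fin d) ℂ}
    (h : ρ ∈ schmidtSet (Fin d) (Fin d) k) (hy : flipVal ρ ≤ 1)
    (hx : (k - 1 : ℝ) * (1 - flipVal ρ) < omegaVal ρ) : schmidtNumber ρ = k := by
  refine le_antisymm (Nat.sInf_le h) (le_csInf ⟨k, h⟩ fun m hm => ?_)
  by_contra! hlt
  have h1 := omegaVal_le_of_mem_schmidtSet hd hm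
  have h2 : (m : ℝ) ≤ k - 1 := by
    have : (m : ℝ) + 1 ≤ k := by exact_mod_cast hlt
    linarith
  have := mul_le_mul_of_nonneg_right h2 (sub_nonneg.2 hy)
  linarith

/-! ### Algebra of the identity, the flip and `omegaOp` -/

theorem sum_Omega_mul_Omega (hd : Even d) :
    ∑ p : Fin d × Fin d, Omega d p.1 p.2 * Omega d p.1 p.2 = d := by
  rw [Fintype.sum_prod_type]
  simp [Omega_apply hd, sgn_mul_self]

theorem trace_omegaOp (hd : Even d) : (omegaOp d).trace = d := sum_Omega_mul_Omega hd

theorem omegaOp_mul_omegaOp (hd : Even d) : omegaOp d * omegaOp d = (d : ℂ) • omegaOp d := by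
  ext p q
  rw [omegaOp_mul_apply]
  simp only [omegaOp, Matrix.of_apply, Matrix.smul_apply, smul_eq_mul, ← mul_assoc, ← Finset.sum_mul, sum_Omega_mul_Omega hd]
  ring

theorem flipOp_mul_omegaOp (hd : Even d) : flipOp d * omegaOp d = -omegaOp d := by
  ext p q
  rw [flipOp_mul_apply]
  simp [omegaOp, Omega_apply_swap hd p.1 p.2]

theorem trace_omegaOp_mul_flipOp (hd : Even d) : (omegaOp d * flipOp d).trace = -d := by
  rw [Matrix.trace_mul_comm, flipOp_mul_omegaOp hd, Matrix.trace_neg, trace_omegaOp hd]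

theorem flipOp_mul_flipOp : flipOp d * flipOp d = 1 := by
  ext p q
  rw [flipOp_mul_apply, flipOp, Matrix.of_apply, Matrix.one_apply]
  simp only [Prod.ext_iff, Prod.fst_swap, Prod.snd_swap, and_comm]

theorem trace_flipOp : (flipOp d).trace = d := by
  have h : (flipOp d).trace = ∑ p : Fin d × Fin d, if p.2 = p.1 then 1 else 0 := by
    refine Finset.sum_congr rfl fun p _ => ?_
    simp only [Matrix.diag_apply, flipOp, Matrix.of_apply, eq_comm, and_self]
  rw [h, Fintype.sum_prod_type]
  simp

theorem trace_one_prod : (1 : Matrix (Fin d × Fin d) (Fin d × Fin d) ℂ).trace = (d : ℂ) ^ 2 := by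
  simp [sq]

/-! ### The families `sig` and `rho`, and partial transposition -/

/-- The `S ⊗ S`-invariant family that is local-unitary equivalent to `rho`. -/
noncomputable def sig (d : ℕ) (a b : ℝ) : Matrix (Fin d × Fin d) (Fin d × Fin d) ℂ :=
  (((1 - a - b) / (d : ℝ) ^ 2 : ℝ) : ℂ) • 1 + ((a / (d : ℝ) : ℝ) : ℂ) • omegaOp d
    + ((b / (d : ℝ) : ℝ) : ℂ) • flipOp d

theorem omegaVal_comb (hd : Even d) (x y z : ℝ) :
    omegaVal ((x : ℂ) • 1 + (y : ℂ) • omegaOp d + (z : ℂ) • flipOp d)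
      = x * d + y * d ^ 2 - z * d := by
  have h : (omegaOp d * ((x : ℂ) • 1 + (y : ℂ) • omegaOp d + (z : ℂ) • flipOp d)).trace
      = ((x * d + y * d ^ 2 - z * d : ℝ) : ℂ) := by
    simp only [Matrix.mul_add, Matrix.mul_smul, Matrix.mul_one, Matrix.trace_add,
      Matrix.trace_smul, omegaOp_mul_omegaOp hd, trace_omegaOp hd, trace_omegaOp_mul_flipOp hd,
      smul_eq_mul]
    push_cast
    ring
  rw [omegaVal, h, Complex.ofReal_re]

theorem flipVal_comb (hd : Even d) (x y z : ℝ) :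
    flipVal ((x : ℂ) • 1 + (y : ℂ) • omegaOp d + (z : ℂ) • flipOp d)
      = x * d - y * d + z * d ^ 2 := by
  have h : (flipOp d * ((x : ℂ) • 1 + (y : ℂ) • omegaOp d + (z : ℂ) • flipOp d)).trace
      = ((x * d - y * d + z * d ^ 2 : ℝ) : ℂ) := by
    simp only [Matrix.mul_add, Matrix.mul_smul, Matrix.mul_one, Matrix.trace_add,
      Matrix.trace_smul, flipOp_mul_omegaOp hd, trace_omegaOp hd, flipOp_mul_flipOp, trace_flipOp,
      trace_one_prod, Matrix.trace_neg, smul_eq_mul]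
    push_cast
    ring
  rw [flipVal, h, Complex.ofReal_re]

theorem trace_comb (hd : Even d) (x y z : ℝ) :
    ((x : ℂ) • 1 + (y : ℂ) • omegaOp d + (z : ℂ) • flipOp d).trace
      = ((x * d ^ 2 + y * d + z * d : ℝ) : ℂ) := by
  simp only [Matrix.trace_add, Matrix.trace_smul, trace_omegaOp hd, trace_flipOp,
      trace_one_prod, smul_eq_mul]
  push_cast
  ring

theorem omegaVal_sig (hd : Even d) (h0 : d ≠ 0) (a b : ℝ) :
    omegaVal (sig d a b) = (1 - a - b) / d + a * d - b := by
  rw [sig, omegaVal_comb hd]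
  field_simp

theorem flipVal_sig (hd : Even d) (h0 : d ≠ 0) (a b : ℝ) :
    flipVal (sig d a b) = (1 - a - b) / d - a + b * d := by
  rw [sig, flipVal_comb hd]
  field_simp

theorem one_kronecker_conj_apply (A : Matrix (Fin d) (Fin d) ℂ)
    (X : Matrix (Fin d × Fin d) (Fin d × Fin d) ℂ) (p q : Fin d × Fin d) :
    (((1 : Matrix (Fin d) (Fin d) ℂ) ⊗ₖ A) * X *
      ((1 : Matrix (Fin d) (Fin d) ℂ) ⊗ₖ A).conjTranspose) p q
      = ∑ k, ∑ l, A p.2 k * X (p.1, k) (q.1, l) * star (A q.2 l) := by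
  simp only [Matrix.mul_apply, Fintype.sum_prod_type, Matrix.kroneckerMap_apply,
    Matrix.conjTranspose_apply, Matrix.one_apply, ite_mul, one_mul, zero_mul, 
    Finset.sum_ite_irrel, Finset.sum_const_zero, Finset.sum_ite_eq, Finset.mem_univ, if_true,
    apply_ite star, star_zero, mul_ite, mul_zero, Finset.sum_mul]
  exact Finset.sum_comm

theorem one_kronecker_Omega_conj_flipOp (hd : Even d) (p q : Fin d × Fin d) :
    (((1 : Matrix (Fin d) (Fin d) ℂ) ⊗ₖ Omega d) * flipOp d *
      ((1 : Matrix (Fin d) (Fin d) ℂ) ⊗ₖ Omega d).conjTranspose) p q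
      = Omega d p.2 q.1 * Omega d q.2 p.1 := by
  rw [one_kronecker_conj_apply, Finset.sum_eq_single q.1, Finset.sum_eq_single p.1]
  · simp [flipOp, star_Omega_apply hd]
  · intro l _ hl
    simp [flipOp, Ne.symm hl]
  · simp
  · intro k _ hk
    simp [flipOp, hk]
  · simp

/-- $I\otimes\Omega$ maps the vector $\sum\Omega_{ij}|ij\rangle$ to $\sum|jj\rangle$, which is
$\sqrt d\,|\omega\rangle$ because $\Omega\Omega^\top=I$; hence the factor $d$. -/
theorem one_kronecker_Omega_conj_omegaOp (hd : Even d) (h0 : d ≠ 0) :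
    ((1 : Matrix (Fin d) (Fin d) ℂ) ⊗ₖ Omega d) * omegaOp d *
      ((1 : Matrix (Fin d) (Fin d) ℂ) ⊗ₖ Omega d).conjTranspose
      = (d : ℂ) • ketBra (omegaVec d) := by
  have hO (i j : Fin d) : ∑ k, Omega d j k * Omega d i k = if i = j then 1 else 0 := by
    have := congrFun (congrFun (Omega_mul_Omega hd) j) i
    simp only [Matrix.mul_apply, Matrix.neg_apply, Matrix.one_apply] at this
    simp_rw [Omega_apply_swap hd _ i, mul_neg, Finset.sum_neg_distrib, this, neg_neg, eq_comm]
  ext p q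
  rw [one_kronecker_conj_apply]
  have h1 : ∑ k, ∑ l, Omega d p.2 k * omegaOp d (p.1, k) (q.1, l) * star (Omega d q.2 l)
      = (∑ k, Omega d p.2 k * Omega d p.1 k) * ∑ l, Omega d q.2 l * Omega d q.1 l := by
    rw [Finset.sum_mul_sum]
    refine Finset.sum_congr rfl fun k _ => Finset.sum_congr rfl fun l _ => ?_
    simp only [omegaOp, Matrix.of_apply, Complex.star_def, star_Omega_apply hd]
    ring
  have hs : ((1 / √(d : ℝ) : ℝ) : ℂ) * ((1 / √(d : ℝ) : ℝ) : ℂ) = 1 / d := by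
    rw [← Complex.ofReal_mul, div_mul_div_comm, Real.mul_self_sqrt (Nat.cast_nonneg d)]
    simp
  rw [h1, hO, hO, Matrix.smul_apply, ketBra, Matrix.of_apply, omegaVec]
  have hd' : (d : ℂ) ≠ 0 := by exact_mod_cast h0
  by_cases hp : p.1 = p.2 <;> by_cases hq : q.1 = q.2 <;> simp only [hp, hq, if_true, if_false]
  · rw [Complex.star_def, Complex.conj_ofReal, hs]
    simp [hd']
  all_goals simp

theorem conj_sig (hd : Even d) (h0 : d ≠ 0) (a b : ℝ) :
    ((1 : Matrix (Fin d) (Fin d) ℂ) ⊗ₖ Omega d) * sig d a b *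
      ((1 : Matrix (Fin d) (Fin d) ℂ) ⊗ₖ Omega d).conjTranspose = rho d a b := by
  have hU : ((1 : Matrix (Fin d) (Fin d) ℂ) ⊗ₖ Omega d) *
      ((1 : Matrix (Fin d) (Fin d) ℂ) ⊗ₖ Omega d).conjTranspose = 1 :=
    Matrix.mem_unitaryGroup_iff.1
      (kronecker_mem_unitaryGroup (one_mem _) (Omega_mem_unitaryGroup hd))
  have hd' : (d : ℂ) ≠ 0 := by exact_mod_cast h0
  have ha : ((a / (d : ℝ) : ℝ) : ℂ) * d = a := by push_cast; field_simp
  rw [sig, Matrix.mul_add, Matrix.mul_add, Matrix.add_mul, Matrix.add_mul, Matrix.mul_smul,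
    Matrix.mul_smul, Matrix.mul_smul, Matrix.smul_mul, Matrix.smul_mul, Matrix.smul_mul,
    Matrix.mul_one, hU, one_kronecker_Omega_conj_omegaOp hd h0, smul_smul, ha]
  rfl

/-- Partial transposition turns $|\omega\rangle\langle\omega|$ into $F/d$ and the conjugated flip
into `omegaOp`, so the two coefficients trade places. -/
theorem partialTranspose_rho (hd : Even d) (a b : ℝ) :
    partialTranspose (rho d a b) = sig d b a := by
  have hs : ((1 / √(d : ℝ) : ℝ) : ℂ) * ((1 / √(d : ℝ) : ℝ) : ℂ) = 1 / d := by
    rw [← Complex.ofReal_mul, div_mul_div_comm, Real.mul_self_sqrt (Nat.cast_nonneg d)]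
    simp
  ext p q
  simp only [partialTranspose, rho, sig, Matrix.of_apply, Matrix.add_apply, Matrix.smul_apply,
    one_kronecker_Omega_conj_flipOp hd, omegaOp, smul_eq_mul]
  have h1 : ketBra (omegaVec d) (p.1, q.2) (q.1, p.2) = (1 / d : ℂ) * flipOp d p q := by
    simp only [ketBra, omegaVec, flipOp, Matrix.of_apply]
    by_cases h : p.1 = q.2 <;> by_cases h' : q.1 = p.2
    · simp only [h, h', if_true, and_self]
      rw [Complex.star_def, Complex.conj_ofReal, hs, mul_one]
    · simp [h, h', Ne.symm h']
    all_goals simp [h]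
  have h2 : (1 : Matrix (Fin d × Fin d) (Fin d × Fin d) ℂ) (p.1, q.2) (q.1, p.2)
      = (1 : Matrix (Fin d × Fin d) (Fin d × Fin d) ℂ) p q := by
    simp only [Matrix.one_apply, Prod.ext_iff, eq_comm]
  rw [h1, h2, Omega_apply_swap hd q.1 q.2, Omega_apply_swap hd p.1 p.2]
  push_cast
  ring

theorem partialTranspose_partialTranspose {m n : Type*} (X : Matrix (m × n) (m × n) ℂ) :
    partialTranspose (partialTranspose X) = X := rfl

theorem partialTranspose_sig (hd : Even d) (a b : ℝ) :
    partialTranspose (sig d a b) = rho d b a := by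
  rw [← partialTranspose_rho hd, partialTranspose_partialTranspose]

/-! ### Invariance under the symplectic group -/

/-- The defining relation $S^\top\Omega S=\Omega$ multiplied by $\overline S=(S^\top)^{-1}$. It
makes $I\otimes\Omega$ an intertwiner between $S\otimes S$ and $S\otimes\overline S$. -/
theorem map_star_mul_Omega {S : Matrix (Fin d) (Fin d) ℂ} (hS : S ∈ Sp d) :
    S.map star * Omega d = Omega d * S := by
  have h1 : S.map star * S.transpose = 1 := by
    have := congrArg Matrix.transpose (Matrix.mem_unitaryGroup_iff.1 hS.1)
    rwa [Matrix.transpose_mul, Matrix.transpose_one, Matrix.star_eq_conjTranspose] at this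
  have h2 := congrArg (S.map star * ·) hS.2
  simp only [← Matrix.mul_assoc, h1, Matrix.one_mul] at h2
  exact h2.symm

theorem Sp_mul_Omega_mul_transpose (hd : Even d) {S : Matrix (Fin d) (Fin d) ℂ} (hS : S ∈ Sp d) :
    S * Omega d * S.transpose = Omega d := by
  have h1 : S.map star * S.transpose = 1 := by
    have := congrArg Matrix.transpose (Matrix.mem_unitaryGroup_iff.1 hS.1)
    rwa [Matrix.transpose_mul, Matrix.transpose_one, Matrix.star_eq_conjTranspose] at this
  have h2 : S * Omega d = Omega d * S.map star := by
    have h3 := congrArg (fun X => Omega d * X * Omega d) (map_star_mul_Omega hS)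
    simp only [Matrix.mul_assoc, Omega_mul_Omega hd, Matrix.mul_neg, Matrix.mul_one] at h3
    rw [← Matrix.mul_assoc (Omega d), Omega_mul_Omega hd] at h3
    simpa using h3.symm
  rw [h2, Matrix.mul_assoc, h1, Matrix.mul_one]

/-- $A\otimes B$ acts on coefficient matrices as $X\mapsto AXB^\top$, and the range of `omegaOp` is
the line spanned by $\Omega$. -/
theorem kronecker_mul_omegaOp (A B : Matrix (Fin d) (Fin d) ℂ)
    (h : A * Omega d * B.transpose = Omega d) :
    (A ⊗ₖ B) * omegaOp d = omegaOp d := by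
  ext p q
  have h1 := congrFun (congrFun h p.1) p.2
  simp only [Matrix.mul_apply, Matrix.transpose_apply, Finset.sum_mul] at h1
  simp only [Matrix.mul_apply, Fintype.sum_prod_type, Matrix.kroneckerMap_apply, omegaOp,
    Matrix.of_apply, ← mul_assoc, ← Finset.sum_mul]
  rw [← h1, Finset.sum_comm]
  congr 1
  refine Finset.sum_congr rfl fun i _ => Finset.sum_congr rfl fun j _ => ?_
  ring

theorem kronecker_self_mul_flipOp (A : Matrix (Fin d) (Fin d) ℂ) :
    (A ⊗ₖ A) * flipOp d = flipOp d * (A ⊗ₖ A) := by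
  ext p q
  rw [flipOp_mul_apply, Matrix.mul_apply, Finset.sum_eq_single q.swap]
  · simp [flipOp, mul_comm]
  · rintro ⟨a, b⟩ - h
    rw [flipOp, Matrix.of_apply, if_neg, mul_zero]
    rintro ⟨h1, h2⟩
    exact h (Prod.ext h1 h2)
  · simp

theorem omegaOp_conjTranspose (hd : Even d) : (omegaOp d).conjTranspose = omegaOp d := by
  ext p q
  simp [omegaOp, star_Omega_apply hd, mul_comm]

theorem omegaOp_mem_InvSS (hd : Even d) : omegaOp d ∈ InvSS d := by
  intro S hS
  have h1 := kronecker_mul_omegaOp S S (Sp_mul_Omega_mul_transpose hd hS)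
  have h2 := congrArg Matrix.conjTranspose h1
  rw [Matrix.conjTranspose_mul, omegaOp_conjTranspose hd] at h2
  rw [h1, h2]

theorem kronecker_self_mul_conjTranspose {S : Matrix (Fin d) (Fin d) ℂ} (hS : S ∈ Sp d) :
    (S ⊗ₖ S) * (S ⊗ₖ S).conjTranspose = 1 :=
  Matrix.mem_unitaryGroup_iff.1 (kronecker_mem_unitaryGroup hS.1 hS.1)

theorem flipOp_mem_InvSS : flipOp d ∈ InvSS d := by
  intro S hS
  rw [kronecker_self_mul_flipOp, Matrix.mul_assoc, kronecker_self_mul_conjTranspose hS,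
    Matrix.mul_one]

theorem sig_mem_InvSS (hd : Even d) (a b : ℝ) : sig d a b ∈ InvSS d := by
  intro S hS
  rw [sig, Matrix.mul_add, Matrix.mul_add, Matrix.add_mul, Matrix.add_mul, Matrix.mul_smul,
    Matrix.mul_smul, Matrix.mul_smul, Matrix.smul_mul, Matrix.smul_mul, Matrix.smul_mul,
    Matrix.mul_one, kronecker_self_mul_conjTranspose hS, omegaOp_mem_InvSS hd S hS,
    flipOp_mem_InvSS S hS]

theorem rho_mem_InvSSbar (hd : Even d) (h0 : d ≠ 0) (a b : ℝ) : rho d a b ∈ InvSSbar d := by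
  intro S hS
  have h1 : (S ⊗ₖ S.map star) * ((1 : Matrix (Fin d) (Fin d) ℂ) ⊗ₖ Omega d)
      = ((1 : Matrix (Fin d) (Fin d) ℂ) ⊗ₖ Omega d) * (S ⊗ₖ S) := by
    rw [← Matrix.mul_kronecker_mul, ← Matrix.mul_kronecker_mul, Matrix.mul_one, Matrix.one_mul,
      map_star_mul_Omega hS]
  have h2 := congrArg Matrix.conjTranspose h1
  rw [Matrix.conjTranspose_mul, Matrix.conjTranspose_mul] at h2
  have h3 := sig_mem_InvSS hd a b S hS
  rw [← conj_sig hd h0]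
  calc _ = ((S ⊗ₖ S.map star) * ((1 : Matrix (Fin d) (Fin d) ℂ) ⊗ₖ Omega d)) * sig d a b *
        (((1 : Matrix (Fin d) (Fin d) ℂ) ⊗ₖ Omega d).conjTranspose *
          (S ⊗ₖ S.map star).conjTranspose) := by simp only [Matrix.mul_assoc]
    _ = ((1 : Matrix (Fin d) (Fin d) ℂ) ⊗ₖ Omega d) *
        ((S ⊗ₖ S) * sig d a b * (S ⊗ₖ S).conjTranspose) *
          ((1 : Matrix (Fin d) (Fin d) ℂ) ⊗ₖ Omega d).conjTranspose := by
        rw [h1, h2]; simp only [Matrix.mul_assoc]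
    _ = _ := by rw [h3]

theorem localUnitaryEquiv_sig_rho (hd : Even d) (h0 : d ≠ 0) (a b : ℝ) :
    LocalUnitaryEquiv (sig d a b) (rho d a b) :=
  ⟨1, one_mem _, Omega d, Omega_mem_unitaryGroup hd, (conj_sig hd h0 a b).symm⟩

theorem LocalUnitaryEquiv.symm {m n : Type*} [Fintype m] [Fintype n] [DecidableEq m]
    [DecidableEq n] {ρ σ : Matrix (m × n) (m × n) ℂ} (h : LocalUnitaryEquiv ρ σ) :
    LocalUnitaryEquiv σ ρ := by
  obtain ⟨U, hU, W, hW, rfl⟩ := h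
  refine ⟨star U, Unitary.star_mem hU, star W, Unitary.star_mem hW, ?_⟩
  have h1 : (U ⊗ₖ W).conjTranspose * (U ⊗ₖ W) = 1 :=
    Matrix.mem_unitaryGroup_iff'.1 (kronecker_mem_unitaryGroup hU hW)
  rw [Matrix.star_eq_conjTranspose, Matrix.star_eq_conjTranspose, ← Matrix.conjTranspose_kronecker,
    Matrix.conjTranspose_conjTranspose]
  simp only [Matrix.mul_assoc]
  rw [h1, Matrix.mul_one, ← Matrix.mul_assoc, h1, Matrix.one_mul]

/-! ### Rank-one projections and weight blocks -/

section Proj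

variable {ι : Type*} [Fintype ι]

/-- The orthogonal projection onto the line spanned by `v`. -/
noncomputable def proj (v : ι → ℂ) : Matrix ι ι ℂ :=
  (star v ⬝ᵥ v)⁻¹ • Matrix.vecMulVec v (star v)

theorem star_dotProduct_self_ne_zero {v : ι → ℂ} (hv : v ≠ 0) : star v ⬝ᵥ v ≠ 0 :=
  fun h => hv (dotProduct_star_self_eq_zero.1 h)

theorem star_star_dotProduct_self (v : ι → ℂ) : star (star v ⬝ᵥ v) = star v ⬝ᵥ v := by
  rw [← Matrix.star_dotProduct]

theorem proj_mulVec (v w : ι → ℂ) :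
    (proj v).mulVec w = ((star v ⬝ᵥ v)⁻¹ * (star v ⬝ᵥ w)) • v := by
  rw [proj, Matrix.smul_mulVec, Matrix.vecMulVec_mulVec, op_smul_eq_smul, smul_smul]

theorem proj_mulVec_self {v : ι → ℂ} (hv : v ≠ 0) : (proj v).mulVec v = v := by
  rw [proj_mulVec, inv_mul_cancel₀ (star_dotProduct_self_ne_zero hv), one_smul]

theorem proj_mulVec_of_orthogonal {v w : ι → ℂ} (h : star v ⬝ᵥ w = 0) : (proj v).mulVec w = 0 := by
  rw [proj_mulVec, h, mul_zero, zero_smul]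

theorem mul_proj (A : Matrix ι ι ℂ) (v : ι → ℂ) :
    A * proj v = (star v ⬝ᵥ v)⁻¹ • Matrix.vecMulVec (A.mulVec v) (star v) := by
  rw [proj, Matrix.mul_smul, Matrix.mul_vecMulVec]

theorem proj_mul_self {v : ι → ℂ} (hv : v ≠ 0) : proj v * proj v = proj v := by
  rw [mul_proj, proj_mulVec_self hv, proj]

theorem proj_mul_of_orthogonal {v w : ι → ℂ} (h : star v ⬝ᵥ w = 0) : proj v * proj w = 0 := by
  rw [mul_proj, proj_mulVec_of_orthogonal h, Matrix.zero_vecMulVec, smul_zero]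

theorem proj_conjTranspose (v : ι → ℂ) : (proj v).conjTranspose = proj v := by
  rw [proj, Matrix.conjTranspose_smul, Matrix.conjTranspose_vecMulVec, star_star, star_inv₀,
    star_star_dotProduct_self]

theorem proj_neg (v : ι → ℂ) : proj (-v) = proj v := by
  simp [proj]

/-- A block cut out by two rank-one projections is a multiple of the single tensor $v\otimes w$.
This is what turns the vanishing of the other blocks into an eigenvector statement. -/
theorem proj_mul_mul_proj_transpose (v w : ι → ℂ) (M : Matrix ι ι ℂ) :
    proj v * M * (proj w).transpose
      = ((star v ⬝ᵥ v)⁻¹ * (star w ⬝ᵥ w)⁻¹ * (star v ⬝ᵥ M.mulVec (star w))) •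
        Matrix.vecMulVec v w := by
  rw [proj, proj, Matrix.transpose_smul, Matrix.transpose_vecMulVec, Matrix.smul_mul,
    Matrix.smul_mul, Matrix.mul_smul, Matrix.vecMulVec_mul, Matrix.vecMulVec_mul_vecMulVec,
    ← Matrix.dotProduct_mulVec, smul_smul,
    Matrix.vecMulVec_smul, smul_smul]

/-- Blocks of `M` of the wrong degree vanish if `M` is homogeneous under `S ⊗ S`. -/
theorem mul_mul_transpose_eq_zero {S M A B : Matrix ι ι ℂ} {s t ζ : ℂ}
    (hM : S * M * S.transpose = ζ • M) (hA : A * S = s • A) (hB : B * S = t • B)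
    (h : s * t ≠ ζ) : A * M * B.transpose = 0 := by
  have h1 : A * (S * M * S.transpose) * B.transpose = (s * t) • (A * M * B.transpose) := by
    calc _ = (A * S) * M * (B * S).transpose := by
          rw [Matrix.transpose_mul]; simp only [Matrix.mul_assoc]
      _ = _ := by
          rw [hA, hB, Matrix.transpose_smul, Matrix.smul_mul, Matrix.smul_mul, Matrix.mul_smul,
            smul_smul]
  rw [hM, Matrix.mul_smul, Matrix.smul_mul] at h1
  have h2 : (s * t - ζ) • (A * M * B.transpose) = 0 := by rw [sub_smul, ← h1, sub_self]
  exact (smul_eq_zero.1 h2).resolve_left (sub_ne_zero.2 h)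

end Proj

/-! ### The quaternionic structure -/

/-- The quaternionic structure map `v ↦ Ω v̄`. -/
noncomputable def tilde (v : Fin d → ℂ) : Fin d → ℂ := (Omega d).mulVec (star v)

theorem star_Omega_mulVec (hd : Even d) (v : Fin d → ℂ) :
    star ((Omega d).mulVec v) = (Omega d).mulVec (star v) := by
  ext i
  simp [Matrix.mulVec, dotProduct, star_Omega_apply hd]

theorem star_tilde (hd : Even d) (v : Fin d → ℂ) : star (tilde v) = (Omega d).mulVec v := by
  rw [tilde, star_Omega_mulVec hd, star_star]

theorem tilde_tilde (hd : Even d) (v : Fin d → ℂ) : tilde (tilde v) = -v := by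
  rw [tilde, star_tilde hd, Matrix.mulVec_mulVec, Omega_mul_Omega hd, Matrix.neg_mulVec,
    Matrix.one_mulVec]

theorem Omega_mulVec_dotProduct (hd : Even d) (v w : Fin d → ℂ) :
    (Omega d).mulVec v ⬝ᵥ w = -((Omega d).mulVec w ⬝ᵥ v) := by
  rw [← Matrix.vecMul_transpose, Omega_transpose hd, ← Matrix.dotProduct_mulVec,
    Matrix.neg_mulVec, dotProduct_neg, dotProduct_comm]

theorem star_tilde_dotProduct_self (hd : Even d) (v : Fin d → ℂ) : star (tilde v) ⬝ᵥ v = 0 := by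
  have := Omega_mulVec_dotProduct hd v v
  rw [star_tilde hd]
  linear_combination (1 / 2) * this

theorem star_dotProduct_eq_zero_comm {ι : Type*} [Fintype ι] {v w : ι → ℂ}
    (h : star v ⬝ᵥ w = 0) : star w ⬝ᵥ v = 0 := by
  have := congrArg star h
  rwa [← Matrix.star_dotProduct, star_zero] at this

theorem star_dotProduct_tilde_self (hd : Even d) (v : Fin d → ℂ) : star v ⬝ᵥ tilde v = 0 :=
  star_dotProduct_eq_zero_comm (star_tilde_dotProduct_self hd v)

theorem star_tilde_dotProduct_tilde (hd : Even d) (v : Fin d → ℂ) :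
    star (tilde v) ⬝ᵥ tilde v = star v ⬝ᵥ v := by
  rw [star_tilde hd, Omega_mulVec_dotProduct hd, tilde, Matrix.mulVec_mulVec, Omega_mul_Omega hd,
    Matrix.neg_mulVec, Matrix.one_mulVec, neg_dotProduct, neg_neg]

theorem tilde_ne_zero (hd : Even d) {v : Fin d → ℂ} (hv : v ≠ 0) : tilde v ≠ 0 := by
  intro h
  apply star_dotProduct_self_ne_zero hv
  rw [← star_tilde_dotProduct_tilde hd, h, dotProduct_zero]

/-- Complex conjugation followed by $\Omega$ exchanges the lines of $v$ and `tilde v`; this is why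
giving them conjugate phases yields a symplectic matrix. -/
theorem proj_map_star_mul_Omega (hd : Even d) (v : Fin d → ℂ) :
    (proj v).map star * Omega d = Omega d * proj (tilde v) := by
  have h1 : (proj v).map star = (star v ⬝ᵥ v)⁻¹ • Matrix.vecMulVec (star v) v := by
    have h2 : (proj v).map star = (proj v).transpose := by
      conv_rhs => rw [← proj_conjTranspose v]
      rw [Matrix.conjTranspose, Matrix.transpose_map, Matrix.transpose_transpose]
    rw [h2, proj, Matrix.transpose_smul, Matrix.transpose_vecMulVec]
  rw [h1, mul_proj, star_tilde_dotProduct_tilde hd, star_tilde hd, tilde, Matrix.mulVec_mulVec,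
    Omega_mul_Omega hd, Matrix.neg_mulVec, Matrix.one_mulVec, Matrix.smul_mul,
    Matrix.vecMulVec_mul, ← Matrix.mulVec_transpose, Omega_transpose hd, Matrix.neg_mulVec,
    Matrix.vecMulVec_neg, Matrix.neg_vecMulVec]

/-! ### Symplectic phase rotations -/

/-- A complex phase that is not a root of unity of small order. -/
noncomputable def phase : ℂ := ⟨3 / 5, 4 / 5⟩

theorem phase_mul_star : phase * star phase = 1 := by
  rw [phase, Complex.ext_iff]; norm_num [Complex.mul_re, Complex.mul_im]

/-- The symplectic map multiplying `v` by a phase and `tilde v` by its conjugate. -/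
noncomputable def symp (v : Fin d → ℂ) : Matrix (Fin d) (Fin d) ℂ :=
  1 + (phase - 1) • proj v + (star phase - 1) • proj (tilde v)

/-- The projection onto the complement of `v` and `tilde v`. -/
noncomputable def compl (v : Fin d → ℂ) : Matrix (Fin d) (Fin d) ℂ :=
  1 - proj v - proj (tilde v)

theorem proj_mul_symp (hd : Even d) {v : Fin d → ℂ} (hv : v ≠ 0) :
    proj v * symp v = phase • proj v := by
  rw [symp, Matrix.mul_add, Matrix.mul_add, Matrix.mul_smul, Matrix.mul_smul, proj_mul_self hv,
    proj_mul_of_orthogonal (star_dotProduct_tilde_self hd v), Matrix.mul_one]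
  module

theorem proj_tilde_mul_symp (hd : Even d) {v : Fin d → ℂ} (hv : v ≠ 0) :
    proj (tilde v) * symp v = star phase • proj (tilde v) := by
  rw [symp, Matrix.mul_add, Matrix.mul_add, Matrix.mul_smul, Matrix.mul_smul,
    proj_mul_self (tilde_ne_zero hd hv), proj_mul_of_orthogonal (star_tilde_dotProduct_self hd v),
    Matrix.mul_one]
  module

theorem mul_symp_of_mul_proj {A : Matrix (Fin d) (Fin d) ℂ} {v : Fin d → ℂ} (h : A * proj v = 0)
    (h' : A * proj (tilde v) = 0) : A * symp v = (1 : ℂ) • A := by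
  rw [symp, Matrix.mul_add, Matrix.mul_add, Matrix.mul_smul, Matrix.mul_smul, h, h',
    Matrix.mul_one]
  module

theorem compl_mul_symp (hd : Even d) {v : Fin d → ℂ} (hv : v ≠ 0) :
    compl v * symp v = (1 : ℂ) • compl v := by
  apply mul_symp_of_mul_proj
  · rw [compl, Matrix.sub_mul, Matrix.sub_mul, proj_mul_self hv,
      proj_mul_of_orthogonal (star_tilde_dotProduct_self hd v), Matrix.one_mul]
    simp
  · rw [compl, Matrix.sub_mul, Matrix.sub_mul, proj_mul_self (tilde_ne_zero hd hv),
      proj_mul_of_orthogonal (star_dotProduct_tilde_self hd v), Matrix.one_mul]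
    simp

theorem symp_mulVec_self (hd : Even d) {v : Fin d → ℂ} (hv : v ≠ 0) :
    (symp v).mulVec v = phase • v := by
  rw [symp, Matrix.add_mulVec, Matrix.add_mulVec, Matrix.smul_mulVec, Matrix.smul_mulVec,
    proj_mulVec_self hv, proj_mulVec_of_orthogonal (star_tilde_dotProduct_self hd v),
    Matrix.one_mulVec]
  module

theorem symp_mulVec_of_orthogonal {v w : Fin d → ℂ} (h : star v ⬝ᵥ w = 0)
    (h' : star (tilde v) ⬝ᵥ w = 0) : (symp v).mulVec w = w := by
  rw [symp, Matrix.add_mulVec, Matrix.add_mulVec, Matrix.smul_mulVec, Matrix.smul_mulVec,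
    proj_mulVec_of_orthogonal h, proj_mulVec_of_orthogonal h', Matrix.one_mulVec]
  module

theorem symp_mem_Sp (hd : Even d) {v : Fin d → ℂ} (hv : v ≠ 0) : symp v ∈ Sp d := by
  have hU : (symp v).conjTranspose * symp v = 1 := by
    have h1 : (symp v).conjTranspose
        = star phase • proj v + phase • proj (tilde v) + compl v := by
      simp only [symp, compl, Matrix.conjTranspose_add, Matrix.conjTranspose_smul,
        proj_conjTranspose, Matrix.conjTranspose_one, star_sub, star_one, star_star]
      module
    rw [h1, Matrix.add_mul, Matrix.add_mul, Matrix.smul_mul, Matrix.smul_mul, proj_mul_symp hd hv,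
      proj_tilde_mul_symp hd hv, compl_mul_symp hd hv, smul_smul, smul_smul, phase_mul_star,
      mul_comm (star phase), phase_mul_star, compl]
    module
  refine ⟨Matrix.mem_unitaryGroup_iff'.2 hU, ?_⟩
  have h1 : (symp v).map star * Omega d = Omega d * symp v := by
    have h2 : (symp v).map star = 1 + (star phase - 1) • (proj v).map star
        + (phase - 1) • (proj (tilde v)).map star := by
      ext i j
      by_cases h : i = j <;> simp [symp, h]
    rw [h2, Matrix.add_mul, Matrix.add_mul, Matrix.smul_mul, Matrix.smul_mul,
      proj_map_star_mul_Omega hd, proj_map_star_mul_Omega hd, tilde_tilde hd, proj_neg,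
      symp, Matrix.mul_add, Matrix.mul_add, Matrix.mul_smul, Matrix.mul_smul, Matrix.one_mul,
      Matrix.mul_one]
    abel
  have h3 : (symp v).transpose * (symp v).map star = 1 := by
    have := congrArg Matrix.transpose hU
    rwa [Matrix.transpose_mul, Matrix.transpose_one] at this
  rw [Matrix.mul_assoc, ← h1, ← Matrix.mul_assoc, h3, Matrix.one_mul]

/-! ### The commutant on symmetric tensors -/

/-- A matrix on `ℂᵈ ⊗ ℂᵈ` acting on `d × d` matrices. -/
noncomputable def act (R : Matrix (Fin d × Fin d) (Fin d × Fin d) ℂ) :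
    Matrix (Fin d) (Fin d) ℂ →ₗ[ℂ] Matrix (Fin d) (Fin d) ℂ where
  toFun Y := Matrix.of fun i j => R.mulVec (fun p => Y p.1 p.2) (i, j)
  map_add' X Y := by
    ext i j
    simp [Matrix.mulVec, dotProduct, mul_add, Finset.sum_add_distrib]
  map_smul' c Y := by
    ext i j
    simp only [Matrix.mulVec, dotProduct, Matrix.smul_apply, Matrix.of_apply, smul_eq_mul,
      RingHom.id_apply, Finset.mul_sum]
    exact Finset.sum_congr rfl fun _ _ => by ring

theorem act_apply (R : Matrix (Fin d × Fin d) (Fin d × Fin d) ℂ) (Y : Matrix (Fin d) (Fin d) ℂ)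
    (i j : Fin d) : act R Y i j = ∑ p : Fin d × Fin d, R (i, j) p * Y p.1 p.2 := rfl

theorem act_single (R : Matrix (Fin d × Fin d) (Fin d × Fin d) ℂ) (i j k l : Fin d) :
    act R (Matrix.single k l 1) i j = R (i, j) (k, l) := by
  rw [act_apply, Finset.sum_eq_single (k, l)]
  · simp
  · rintro ⟨a, b⟩ - h
    rw [Matrix.single_apply, if_neg, mul_zero]
    rintro ⟨rfl, rfl⟩
    exact h rfl
  · simp

/-- On coefficient matrices $S\otimes S$ is $Y\mapsto SYS^\top$, so invariance of $R$ says that `act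
R` is equivariant. -/
theorem act_conj {R : Matrix (Fin d × Fin d) (Fin d × Fin d) ℂ} (hR : R ∈ InvSS d)
    {S : Matrix (Fin d) (Fin d) ℂ} (hS : S ∈ Sp d) (Y : Matrix (Fin d) (Fin d) ℂ) :
    act R (S * Y * S.transpose) = S * act R Y * S.transpose := by
  have hU : (S ⊗ₖ S).conjTranspose * (S ⊗ₖ S) = 1 :=
    Matrix.mem_unitaryGroup_iff'.1 (kronecker_mem_unitaryGroup hS.1 hS.1)
  have hc : R * (S ⊗ₖ S) = (S ⊗ₖ S) * R := by
    conv_lhs => rw [← hR S hS]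
    rw [Matrix.mul_assoc, hU, Matrix.mul_one]
  have hv (Z : Matrix (Fin d) (Fin d) ℂ) :
      (fun p : Fin d × Fin d => (S * Z * S.transpose) p.1 p.2)
        = (S ⊗ₖ S).mulVec fun p => Z p.1 p.2 := by
    ext p
    simp only [Matrix.mul_apply, Matrix.transpose_apply, Matrix.mulVec, dotProduct,
      Fintype.sum_prod_type, Matrix.kroneckerMap_apply, Finset.sum_mul]
    rw [Finset.sum_comm]
    exact Finset.sum_congr rfl fun i _ => Finset.sum_congr rfl fun j _ => by ring
  ext i j
  have h1 := congrFun (hv (act R Y)) (i, j)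
  rw [h1]
  change R.mulVec (fun p : Fin d × Fin d => (S * Y * S.transpose) p.1 p.2) (i, j) = _
  rw [hv, Matrix.mulVec_mulVec, hc, ← Matrix.mulVec_mulVec]
  rfl

theorem act_homogeneous {R : Matrix (Fin d × Fin d) (Fin d × Fin d) ℂ} (hR : R ∈ InvSS d)
    {S : Matrix (Fin d) (Fin d) ℂ} (hS : S ∈ Sp d) {Y : Matrix (Fin d) (Fin d) ℂ} {ζ : ℂ}
    (hY : S * Y * S.transpose = ζ • Y) : S * act R Y * S.transpose = ζ • act R Y := by
  rw [← act_conj hR hS, hY, map_smul]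

theorem eq_proj_add_proj_add_compl (v : Fin d → ℂ) : proj v + proj (tilde v) + compl v = 1 := by
  rw [compl]; abel

theorem eq_sum_blocks (v : Fin d → ℂ) (M : Matrix (Fin d) (Fin d) ℂ) :
    M = (proj v + proj (tilde v) + compl v) * M *
      (proj v + proj (tilde v) + compl v).transpose := by
  rw [eq_proj_add_proj_add_compl]; simp

/-- Under `symp v` the nine blocks of $M$ have weights that are products of two of phase, conjugate
phase and $1$. Only the block of $v\otimes v$ has weight phase squared. -/
theorem eq_block_of_weight_two (hd : Even d) {v : Fin d → ℂ} (hv : v ≠ 0)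
    {M : Matrix (Fin d) (Fin d) ℂ}
    (hM : symp v * M * (symp v).transpose = (phase * phase) • M) :
    M = proj v * M * (proj v).transpose := by
  have h1 := proj_mul_symp hd hv
  have h2 := proj_tilde_mul_symp hd hv
  have h3 := compl_mul_symp hd hv
  conv_lhs => rw [eq_sum_blocks v M]
  simp only [Matrix.transpose_add, Matrix.add_mul, Matrix.mul_add]
  rw [mul_mul_transpose_eq_zero hM h1 h2, mul_mul_transpose_eq_zero hM h1 h3,
    mul_mul_transpose_eq_zero hM h2 h1, mul_mul_transpose_eq_zero hM h2 h2,
    mul_mul_transpose_eq_zero hM h2 h3, mul_mul_transpose_eq_zero hM h3 h1,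
    mul_mul_transpose_eq_zero hM h3 h2, mul_mul_transpose_eq_zero hM h3 h3]
  · simp
  -- The phase $(3+4i)/5$ has rational coordinates, so each inequality of weights is a numerical
  -- check.
  all_goals
    intro h
    rw [phase, Complex.ext_iff] at h
    norm_num [Complex.mul_re, Complex.mul_im] at h

theorem eq_block_of_weight_one (hd : Even d) {v : Fin d → ℂ} (hv : v ≠ 0)
    {M : Matrix (Fin d) (Fin d) ℂ}
    (hM : symp v * M * (symp v).transpose = phase • M) :
    M = proj v * M * (compl v).transpose + compl v * M * (proj v).transpose := by
  have h1 := proj_mul_symp hd hv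
  have h2 := proj_tilde_mul_symp hd hv
  have h3 := compl_mul_symp hd hv
  conv_lhs => rw [eq_sum_blocks v M]
  simp only [Matrix.transpose_add, Matrix.add_mul, Matrix.mul_add]
  rw [mul_mul_transpose_eq_zero hM h1 h2, mul_mul_transpose_eq_zero hM h1 h1,
    mul_mul_transpose_eq_zero hM h2 h1, mul_mul_transpose_eq_zero hM h2 h2,
    mul_mul_transpose_eq_zero hM h2 h3, mul_mul_transpose_eq_zero hM h3 h2,
    mul_mul_transpose_eq_zero hM h3 h3]
  · simp [add_comm]
  all_goals
    intro h
    rw [phase, Complex.ext_iff] at h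
    norm_num [Complex.mul_re, Complex.mul_im] at h

theorem mul_vecMulVec_mul_transpose (S : Matrix (Fin d) (Fin d) ℂ) (v w : Fin d → ℂ) :
    S * Matrix.vecMulVec v w * S.transpose = Matrix.vecMulVec (S.mulVec v) (S.mulVec w) := by
  rw [Matrix.mul_vecMulVec, Matrix.vecMulVec_mul, Matrix.vecMul_transpose]

theorem exists_act_vecMulVec_self (hd : Even d)
    {R : Matrix (Fin d × Fin d) (Fin d × Fin d) ℂ} (hR : R ∈ InvSS d) {v : Fin d → ℂ}
    (hv : v ≠ 0) : ∃ c : ℂ, act R (Matrix.vecMulVec v v) = c • Matrix.vecMulVec v v := by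
  have hM := act_homogeneous hR (symp_mem_Sp hd hv) (Y := Matrix.vecMulVec v v)
    (ζ := phase * phase) (by
      rw [mul_vecMulVec_mul_transpose, symp_mulVec_self hd hv, Matrix.vecMulVec_smul,
        Matrix.smul_vecMulVec, smul_smul])
  rw [eq_block_of_weight_two hd hv hM, proj_mul_mul_proj_transpose]
  exact ⟨_, rfl⟩

/-- Every $v\otimes v$ is an eigenvector of `act R`; polarisation with $v=e_k\pm e_l$ forces one
common eigenvalue on all symmetric tensors. -/
theorem exists_act_add_swap (hd : Even d) (h0 : 0 < d)
    {R : Matrix (Fin d × Fin d) (Fin d × Fin d) ℂ} (hR : R ∈ InvSS d) :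
    ∃ c : ℂ, ∀ k l : Fin d, act R (Matrix.single k l 1 + Matrix.single l k 1)
      = c • (Matrix.single k l 1 + Matrix.single l k 1) := by
  have hs (k : Fin d) : (Pi.single k 1 : Fin d → ℂ) ≠ 0 := by simp
  have hE (k l : Fin d) : Matrix.vecMulVec (Pi.single k (1 : ℂ)) (Pi.single l 1)
      = Matrix.single k l 1 := (Matrix.single_eq_single_vecMulVec_single k l).symm
  have hdiag (k : Fin d) : ∃ c : ℂ, act R (Matrix.single k k 1) = c • Matrix.single k k 1 := by
    have := exists_act_vecMulVec_self hd hR (hs k)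
    rwa [hE] at this
  choose c hc using hdiag
  have hoff {k l : Fin d} (hkl : k ≠ l) : c k = c l ∧
      act R (Matrix.single k l 1 + Matrix.single l k 1)
        = c k • (Matrix.single k l 1 + Matrix.single l k 1) := by
    have hexp (t : ℂ) : Matrix.vecMulVec (Pi.single k (1 : ℂ) + t • Pi.single l 1)
        (Pi.single k (1 : ℂ) + t • Pi.single l 1) = Matrix.single k k 1
          + t • (Matrix.single k l 1 + Matrix.single l k 1)
          + (t * t) • Matrix.single l l (1 : ℂ) := by
      simp only [Matrix.add_vecMulVec, Matrix.vecMulVec_add, Matrix.smul_vecMulVec,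
        Matrix.vecMulVec_smul, hE]
      module
    have hne (t : ℂ) : (Pi.single k (1 : ℂ) + t • Pi.single l 1 : Fin d → ℂ) ≠ 0 := by
      intro h
      have := congrFun h k
      simp [hkl] at this
    obtain ⟨a, ha⟩ := exists_act_vecMulVec_self hd hR (hne 1)
    obtain ⟨b, hb⟩ := exists_act_vecMulVec_self hd hR (hne (-1))
    rw [hexp] at ha hb
    simp only [map_add, map_smul, hc] at ha hb
    -- Adding the two eigenvector equations cancels the off-diagonal part on the left. The entry at
    -- $(k,l)$ then gives $a=b$, and the diagonal entries give $c_k=c_l=a$.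
    have e1 := congrArg₂ (· + ·) ha hb
    have k1 := congrFun (congrFun e1 k) k
    have k2 := congrFun (congrFun e1 l) l
    have k3 := congrFun (congrFun e1 k) l
    simp [hkl, hkl.symm] at k1 k2 k3
    have hab : a = b := by linear_combination -k3
    have hka : c k = a := by rw [hab] at k1 ⊢; linear_combination (1 / 2) * k1
    have hla : c l = a := by rw [hab] at k2 ⊢; linear_combination (1 / 2) * k2
    refine ⟨hka.trans hla.symm, ?_⟩
    rw [map_add]
    rw [hka, hla] at ha
    rw [hka]
    linear_combination (norm := module) ha
  refine ⟨c ⟨0, h0⟩, fun k l => ?_⟩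
  have hck : c k = c ⟨0, h0⟩ := by
    by_cases h : k = ⟨0, h0⟩
    · rw [h]
    · exact (hoff h).1
  by_cases h : k = l
  · subst h
    rw [map_add, hc, hck, smul_add]
  · rw [(hoff h).2, hck]

/-- $R$ maps symmetric tensors to symmetric tensors. By hermiticity it also preserves the orthogonal
complement, the antisymmetric tensors, so it commutes with transposition. -/
theorem act_transpose (hd : Even d) (h0 : 0 < d) {R : Matrix (Fin d × Fin d) (Fin d × Fin d) ℂ}
    (hR : R ∈ InvSS d) (hH : R.IsHermitian) (Y : Matrix (Fin d) (Fin d) ℂ) :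
    act R Y.transpose = (act R Y).transpose := by
  obtain ⟨c, hc⟩ := exists_act_add_swap hd h0 hR
  have h1 (i j k l : Fin d) : R (i, j) (k, l) + R (i, j) (l, k)
      = R (j, i) (k, l) + R (j, i) (l, k) := by
    have e1 := congrFun (congrFun (hc k l) i) j
    have e2 := congrFun (congrFun (hc k l) j) i
    simp only [map_add, Matrix.add_apply, act_single, Matrix.smul_apply] at e1 e2
    rw [e1, e2]
    simp only [Matrix.single_apply, and_comm, add_comm]
  have h2 (i j k l : Fin d) : R (i, j) (k, l) + R (j, i) (k, l)
      = R (i, j) (l, k) + R (j, i) (l, k) := by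
    have := congrArg star (h1 k l i j)
    simpa only [star_add, hH.apply] using this
  have h3 (i j k l : Fin d) : R (i, j) (l, k) = R (j, i) (k, l) := by
    linear_combination (1 / 2) * h1 i j k l - (1 / 2) * h2 i j k l
  ext i j
  rw [Matrix.transpose_apply, act_apply, act_apply,
    ← (Equiv.prodComm (Fin d) (Fin d)).sum_comp]
  refine Finset.sum_congr rfl fun ⟨k, l⟩ _ => ?_
  simp only [Equiv.prodComm_apply, Prod.swap, Matrix.transpose_apply, h3]

/-! ### The commutant on isotropic wedges -/

/-- The antisymmetrised tensor `v ⊗ w - w ⊗ v`. -/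
noncomputable def wedge (v w : Fin d → ℂ) : Matrix (Fin d) (Fin d) ℂ :=
  Matrix.vecMulVec v w - Matrix.vecMulVec w v

theorem wedge_transpose (v w : Fin d → ℂ) : (wedge v w).transpose = -wedge v w := by
  rw [wedge, Matrix.transpose_sub, Matrix.transpose_vecMulVec, Matrix.transpose_vecMulVec, neg_sub]

theorem wedge_add (v w w' : Fin d → ℂ) : wedge v (w + w') = wedge v w + wedge v w' := by
  simp only [wedge, Matrix.add_vecMulVec, Matrix.vecMulVec_add]; abel

theorem add_wedge (v v' w : Fin d → ℂ) : wedge (v + v') w = wedge v w + wedge v' w := by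
  simp only [wedge, Matrix.add_vecMulVec, Matrix.vecMulVec_add]; abel

theorem wedge_smul (c : ℂ) (v w : Fin d → ℂ) : wedge v (c • w) = c • wedge v w := by
  simp only [wedge, Matrix.smul_vecMulVec, Matrix.vecMulVec_smul, smul_sub]

theorem wedge_comm (v w : Fin d → ℂ) : wedge v w = -wedge w v := by
  rw [wedge, wedge, neg_sub]

theorem wedge_self (v : Fin d → ℂ) : wedge v v = 0 := sub_self _

/-- `v` and `w` are nonzero and `w` is orthogonal to the quaternionic line of `v`. -/
structure Isotropic (v w : Fin d → ℂ) : Prop where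
  left_ne_zero : v ≠ 0
  right_ne_zero : w ≠ 0
  orthogonal : star v ⬝ᵥ w = 0
  tilde_orthogonal : star (tilde v) ⬝ᵥ w = 0

theorem Isotropic.symm (hd : Even d) {v w : Fin d → ℂ} (h : Isotropic v w) : Isotropic w v := by
  refine ⟨h.2, h.1, star_dotProduct_eq_zero_comm h.3, ?_⟩
  rw [star_tilde hd, Omega_mulVec_dotProduct hd, ← star_tilde hd, h.4, neg_zero]

theorem Isotropic.proj_mul_compl (hd : Even d) {v w : Fin d → ℂ} (h : Isotropic v w) :
    proj v * compl w = proj v := by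
  rw [compl, Matrix.mul_sub, Matrix.mul_sub, proj_mul_of_orthogonal h.3,
    proj_mul_of_orthogonal (star_dotProduct_eq_zero_comm (h.symm hd).4), Matrix.mul_one, sub_zero,
    sub_zero]

theorem Isotropic.compl_mul_proj {v w : Fin d → ℂ} (h : Isotropic v w) :
    compl v * proj w = proj w := by
  rw [compl, Matrix.sub_mul, Matrix.sub_mul, proj_mul_of_orthogonal h.3,
    proj_mul_of_orthogonal h.4, Matrix.one_mul, sub_zero, sub_zero]

/-- The image has weight one under both `symp v` and `symp w`. One tensor leg must then lie along
$v$ and the other along $w$, and antisymmetry leaves only a multiple of $v\wedge w$. -/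
theorem exists_act_wedge (hd : Even d) (h0 : 0 < d)
    {R : Matrix (Fin d × Fin d) (Fin d × Fin d) ℂ} (hR : R ∈ InvSS d) (hH : R.IsHermitian)
    {v w : Fin d → ℂ} (h : Isotropic v w) : ∃ c : ℂ, act R (wedge v w) = c • wedge v w := by
  have h' := h.symm hd
  set M := act R (wedge v w) with hM
  have hMt : M.transpose = -M := by
    rw [hM, ← act_transpose hd h0 hR hH, wedge_transpose, map_neg]
  have hv : symp v * wedge v w * (symp v).transpose = phase • wedge v w := by
    simp only [wedge, Matrix.mul_sub, Matrix.sub_mul, mul_vecMulVec_mul_transpose,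
      symp_mulVec_self hd h.1, symp_mulVec_of_orthogonal h.3 h.4, Matrix.smul_vecMulVec,
      Matrix.vecMulVec_smul, smul_sub]
  have hw : symp w * wedge v w * (symp w).transpose = phase • wedge v w := by
    simp only [wedge, Matrix.mul_sub, Matrix.sub_mul, mul_vecMulVec_mul_transpose,
      symp_mulVec_self hd h.2, symp_mulVec_of_orthogonal h'.3 h'.4, Matrix.smul_vecMulVec,
      Matrix.vecMulVec_smul, smul_sub]
  have ev := eq_block_of_weight_one hd h.1 (act_homogeneous hR (symp_mem_Sp hd h.1) hv)
  have ew := eq_block_of_weight_one hd h.2 (act_homogeneous hR (symp_mem_Sp hd h.2) hw)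
  rw [← hM] at ev ew
  have h1 : proj v * M = proj v * M * (proj w).transpose := by
    conv_lhs => rw [ew]
    rw [Matrix.mul_add, ← Matrix.mul_assoc, ← Matrix.mul_assoc, ← Matrix.mul_assoc,
      ← Matrix.mul_assoc, proj_mul_of_orthogonal h.3, h.proj_mul_compl hd]
    simp
  have h2 : proj v * M * (compl v).transpose = proj v * M * (proj w).transpose := by
    conv_lhs => rw [h1, Matrix.mul_assoc, ← Matrix.transpose_mul, h.compl_mul_proj]
  have h3 : compl v * M * (proj v).transpose = -(proj v * M * (proj w).transpose).transpose := by
    rw [← h2, Matrix.transpose_mul, Matrix.transpose_mul, Matrix.transpose_transpose, hMt,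
      Matrix.neg_mul, Matrix.mul_neg, neg_neg, Matrix.mul_assoc]
  rw [h2, h3, proj_mul_mul_proj_transpose, Matrix.transpose_smul, Matrix.transpose_vecMulVec] at ev
  rw [ev, wedge, ← smul_neg, ← smul_add, ← sub_eq_add_neg]
  exact ⟨_, rfl⟩

/-- If two independent eigenvectors have a sum that is again an eigenvector, their eigenvalues
agree. The entries at $(i,j)$ and $(i',j')$ certify independence. -/
theorem act_wedge_eq_of_add (hd : Even d) (h0 : 0 < d)
    {R : Matrix (Fin d × Fin d) (Fin d × Fin d) ℂ} (hR : R ∈ InvSS d) (hH : R.IsHermitian)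
    {v w w' : Fin d → ℂ} (h : Isotropic v (w + w')) (h' : Isotropic v w') {i j i' j' : Fin d}
    (h1 : wedge v w i j ≠ 0) (h2 : wedge v w' i j = 0) (h3 : wedge v w i' j' = 0)
    (h4 : wedge v w' i' j' ≠ 0) {c : ℂ} (hc : act R (wedge v w) = c • wedge v w) :
    act R (wedge v w') = c • wedge v w' := by
  obtain ⟨a, ha⟩ := exists_act_wedge hd h0 hR hH h
  obtain ⟨b, hb⟩ := exists_act_wedge hd h0 hR hH h'
  rw [wedge_add, map_add, hc, hb] at ha
  have e1 := congrFun (congrFun ha i) j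
  have e2 := congrFun (congrFun ha i') j'
  simp only [Matrix.add_apply, Matrix.smul_apply, smul_eq_mul, h2, h3, mul_zero, add_zero,
    zero_add] at e1 e2
  rw [hb, mul_right_cancel₀ h4 e2, mul_right_cancel₀ h1 e1]

/-- The standard basis vectors. -/
noncomputable def e (k : Fin d) : Fin d → ℂ := Pi.single k 1

theorem e_apply (k i : Fin d) : e k i = if i = k then 1 else 0 := Pi.single_apply _ _ _

theorem star_e (k : Fin d) : star (e k) = e k := by
  ext i; rw [Pi.star_apply, e_apply]; split_ifs <;> simp

theorem e_dotProduct (k : Fin d) (v : Fin d → ℂ) : e k ⬝ᵥ v = v k := single_one_dotProduct _ _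

theorem Omega_mulVec_e (hd : Even d) (k : Fin d) :
    (Omega d).mulVec (e k) = -sgn k • e (bar k) := by
  ext i
  rw [e, Matrix.mulVec_single_one, Matrix.col_apply, Omega_apply hd, Pi.smul_apply, e_apply]
  by_cases h : i = bar k
  · rw [if_pos (by rw [h, bar_bar hd]), if_pos h, h, sgn_bar hd]; simp
  · rw [if_neg (fun h' => h (by rw [h', bar_bar hd])), if_neg h]; simp

theorem wedge_e_apply (k l i j : Fin d) : wedge (e k) (e l) i j
    = (if i = k ∧ j = l then 1 else 0) - if i = l ∧ j = k then 1 else 0 := by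
  simp only [wedge, Matrix.sub_apply, Matrix.vecMulVec_apply, e_apply, ite_and]
  split_ifs <;> simp

theorem isotropic_e (hd : Even d) {k l : Fin d} (h : l ≠ k) (h' : l ≠ bar k) :
    Isotropic (e k) (e l) := by
  refine ⟨by simp [e], by simp [e], ?_, ?_⟩
  · rw [star_e, e_dotProduct, e_apply, if_neg h.symm]
  · rw [star_tilde hd, Omega_mulVec_e hd, smul_dotProduct, e_dotProduct, e_apply, if_neg h'.symm,
      smul_zero]

theorem isotropic_e_add (hd : Even d) {k l m : Fin d} (h : l ≠ k) (h' : l ≠ bar k) (g : m ≠ k)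
    (g' : m ≠ bar k) (hlm : l ≠ m) : Isotropic (e k) (e l + e m) := by
  have h1 := isotropic_e hd h h'
  have h2 := isotropic_e hd g g'
  refine ⟨h1.1, fun h3 => ?_, ?_, ?_⟩
  · have := congrFun h3 l
    simp [e_apply, hlm] at this
  · rw [dotProduct_add, h1.3, h2.3, add_zero]
  · rw [dotProduct_add, h1.4, h2.4, add_zero]

/-- The eigenvalue propagates between isotropic pairs that share a basis vector, and the graph of
such pairs is connected for $d\ge4$. -/
theorem exists_act_wedge_e (hd : Even d) (h4 : 4 ≤ d)
    {R : Matrix (Fin d × Fin d) (Fin d × Fin d) ℂ} (hR : R ∈ InvSS d) (hH : R.IsHermitian) :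
    ∃ c : ℂ, ∀ k l : Fin d, l ≠ bar k → act R (wedge (e k) (e l)) = c • wedge (e k) (e l) := by
  have h0 : 0 < d := by omega
  obtain ⟨k₀, l₀, h₀, h₀'⟩ : ∃ k l : Fin d, l ≠ k ∧ l ≠ bar k := by
    refine ⟨⟨0, h0⟩, ⟨1, by omega⟩, by simp, fun h => ?_⟩
    rw [Fin.ext_iff, bar_val] at h
    simp only at h
    split_ifs at h <;> omega
  obtain ⟨c, hc⟩ := exists_act_wedge hd h0 hR hH (isotropic_e hd h₀ h₀')
  have hstep {k l m : Fin d} (h : l ≠ k) (h' : l ≠ bar k) (g : m ≠ k) (g' : m ≠ bar k)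
      (hl : act R (wedge (e k) (e l)) = c • wedge (e k) (e l)) :
      act R (wedge (e k) (e m)) = c • wedge (e k) (e m) := by
    by_cases hlm : l = m
    · rwa [← hlm]
    refine act_wedge_eq_of_add hd h0 hR hH (isotropic_e_add hd h h' g g' hlm) (isotropic_e hd g g')
      (i := k) (j := l) (i' := k) (j' := m) ?_ ?_ ?_ ?_ hl
    all_goals simp [wedge_e_apply, h, g, h.symm, g.symm, hlm, Ne.symm hlm]
  have hsymm {k l : Fin d} (hl : act R (wedge (e k) (e l)) = c • wedge (e k) (e l)) :
      act R (wedge (e l) (e k)) = c • wedge (e l) (e k) := by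
    rw [wedge_comm, map_neg, hl, smul_neg]
  have hbar {k l : Fin d} (h' : l ≠ bar k) : k ≠ bar l := fun h => h' (by rw [h, bar_bar hd])
  have hall {k l : Fin d} (h : l ≠ k) (h' : l ≠ bar k)
      (hl : act R (wedge (e k) (e l)) = c • wedge (e k) (e l)) (m : Fin d) (hm : m ≠ bar k) :
      act R (wedge (e k) (e m)) = c • wedge (e k) (e m) := by
    by_cases hmk : m = k
    · rw [hmk, wedge_self, map_zero, smul_zero]
    · exact hstep h h' hmk hm hl
  have hk₀ := hall h₀ h₀' hc
  have hl₀ := hall h₀.symm (hbar h₀') (hsymm hc)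
  refine ⟨c, fun k => ?_⟩
  by_cases h1 : k = k₀
  · rw [h1]; exact hk₀
  by_cases h2 : k = bar k₀
  -- The partner of $k_0$ is the one index not paired isotropically with $k_0$; it is reached
  -- through $l_0$ instead.
  · have h3 : k ≠ l₀ := by rw [h2]; exact h₀'.symm
    have h5 : k ≠ bar l₀ := by
      rw [h2]; intro h
      exact h₀ (by rw [← bar_bar hd l₀, ← h, bar_bar hd])
    exact hall h3.symm (hbar h5) (hsymm (hl₀ k h5))
  · exact hall (Ne.symm h1) (hbar h2) (hsymm (hk₀ k h2))

/-! ### The commutant on the paired directions -/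

/-- The part of `Ω` supported on the quaternionic line of the `k`-th basis vector. -/
noncomputable def OmegaBlock (k : Fin d) : Matrix (Fin d) (Fin d) ℂ :=
  sgn k • wedge (e k) (e (bar k))

theorem OmegaBlock_bar (hd : Even d) (k : Fin d) : OmegaBlock (bar k) = OmegaBlock k := by
  rw [OmegaBlock, OmegaBlock, bar_bar hd, sgn_bar hd, wedge_comm (e (bar k)), smul_neg, neg_smul,
    neg_neg]

theorem sum_OmegaBlock (hd : Even d) : ∑ k, OmegaBlock k = (2 : ℂ) • Omega d := by
  ext i j
  rw [Matrix.sum_apply]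
  simp only [OmegaBlock, Matrix.smul_apply, wedge_e_apply, smul_eq_mul, mul_sub,
    Finset.sum_sub_distrib]
  have h1 : ∑ k, sgn k * (if i = k ∧ j = bar k then (1 : ℂ) else 0) = Omega d i j := by
    simp [Omega_apply hd, ite_and]
  have h2 : ∑ k, sgn k * (if i = bar k ∧ j = k then (1 : ℂ) else 0) = Omega d j i := by
    simp [Omega_apply hd, ite_and, and_comm]
  rw [h1, h2, Omega_apply_swap hd i j]
  ring

theorem wedge_e_add_e_sub (k l : Fin d) :
    wedge (e k + e l) (e k + (-1 : ℂ) • e l) = (-2 : ℂ) • wedge (e k) (e l) := by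
  rw [add_wedge, wedge_add, wedge_add, wedge_smul, wedge_smul, wedge_self, wedge_self,
    wedge_comm (e l) (e k)]
  module

/-- A difference of two blocks is, up to isotropic basis wedges, the wedge of $e_k+e_l$ with
$\mathrm{sgn}_k e_{\bar k}-\mathrm{sgn}_l e_{\bar l}$. This pair is isotropic, because the two
contributions to the pairing with `tilde (e k + e l)` cancel. -/
theorem act_OmegaBlock_sub (hd : Even d) (h4 : 4 ≤ d)
    {R : Matrix (Fin d × Fin d) (Fin d × Fin d) ℂ} (hR : R ∈ InvSS d) (hH : R.IsHermitian) {c : ℂ}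
    (hc : ∀ k l : Fin d, l ≠ bar k → act R (wedge (e k) (e l)) = c • wedge (e k) (e l))
    (k l : Fin d) :
    act R (OmegaBlock k - OmegaBlock l) = c • (OmegaBlock k - OmegaBlock l) := by
  have h0 : 0 < d := by omega
  by_cases hlk : l = k
  · rw [hlk, sub_self, map_zero, smul_zero]
  by_cases hlk' : l = bar k
  · rw [hlk', OmegaBlock_bar hd, sub_self, map_zero, smul_zero]
  have hkl' : k ≠ bar l := fun h => hlk' (by rw [h, bar_bar hd])
  have hkk := bar_ne hd k
  have hll := bar_ne hd l
  have hbb : bar k ≠ bar l := fun h => hlk (by rw [← bar_bar hd l, ← h, bar_bar hd])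
  have hsub : Isotropic (e k + e l) (e k + (-1 : ℂ) • e l) := by
    refine ⟨fun h => ?_, fun h => ?_, ?_, ?_⟩
    · have := congrFun h k
      simp [e_apply, Ne.symm hlk] at this
    · have := congrFun h k
      simp [e_apply, Ne.symm hlk] at this
    · simp [star_add, star_e, e_dotProduct, e_apply, hlk, Ne.symm hlk]
    · simp [star_tilde hd, Matrix.mulVec_add, Omega_mulVec_e hd, e_dotProduct, e_apply, hkk, hll,
        Ne.symm hlk', Ne.symm hkl']
  have hw : Isotropic (e k + e l) (sgn k • e (bar k) + (-sgn l) • e (bar l)) := by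
    refine ⟨hsub.1, fun h => ?_, ?_, ?_⟩
    · have := congrFun h (bar k)
      simp [e_apply, hbb, sgn_ne_zero] at this
    · simp [star_add, star_e, e_dotProduct, e_apply, hkk.symm, hll.symm, hlk', hkl']
    · simp [star_tilde hd, Matrix.mulVec_add, Omega_mulVec_e hd, e_dotProduct, e_apply, hbb,
        hbb.symm, sgn_mul_self]
  have hsum : Isotropic (e k + e l) (e k + (-1 : ℂ) • e l
      + (sgn k • e (bar k) + (-sgn l) • e (bar l))) := by
    refine ⟨hsub.1, fun h => ?_, ?_, ?_⟩
    · have := congrFun h k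
      simp [e_apply, Ne.symm hlk, hkk.symm, hkl'] at this
    · rw [dotProduct_add, hsub.3, hw.3, add_zero]
    · rw [dotProduct_add, hsub.4, hw.4, add_zero]
  have hexp : wedge (e k + e l) (sgn k • e (bar k) + (-sgn l) • e (bar l))
      = OmegaBlock k - OmegaBlock l + ((-sgn l) • wedge (e k) (e (bar l))
        + sgn k • wedge (e l) (e (bar k))) := by
    rw [add_wedge, wedge_add, wedge_add, wedge_smul, wedge_smul, wedge_smul, wedge_smul,
      OmegaBlock, OmegaBlock]
    module
  -- The companion wedge $(e_k+e_l)\wedge(e_k-e_l)=-2\,e_k\wedge e_l$ already has eigenvalue $c$, so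
  -- it transmits that value.
  have hact := act_wedge_eq_of_add hd h0 hR hH hsum hw (i := k) (j := l) (i' := k) (j' := bar k)
    (c := c) (by
      rw [wedge_e_add_e_sub]
      simp [wedge_e_apply, Ne.symm hlk]) (by
      rw [hexp]
      simp [OmegaBlock, wedge_e_apply, Ne.symm hlk, hlk, hlk', hll.symm, hkl', hkk.symm]) (by
      rw [wedge_e_add_e_sub]
      simp [wedge_e_apply, Ne.symm hlk, Ne.symm hlk', hkk]) (by
      rw [hexp]
      simp [OmegaBlock, wedge_e_apply, Ne.symm hlk, hkl', hkk, hbb, sgn_ne_zero, hkk.symm]) (by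
      rw [wedge_e_add_e_sub, map_smul, hc k l hlk', smul_comm])
  rw [hexp, map_add, map_add, map_smul, map_smul,
    hc k (bar l) (fun h => hbb h.symm), hc l (bar k) hbb] at hact
  linear_combination (norm := module) hact

theorem dotProduct_mulVec_eq_zero_of_proj {ι : Type*} [Fintype ι] {v w : ι → ℂ}
    (hv : v ≠ 0) (hw : w ≠ 0) {M : Matrix ι ι ℂ} (h : proj v * M * (proj w).transpose = 0) :
    star v ⬝ᵥ M.mulVec (star w) = 0 := by
  rw [proj_mul_mul_proj_transpose] at h
  have h1 := star_dotProduct_self_ne_zero hv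
  have h2 := star_dotProduct_self_ne_zero hw
  rcases smul_eq_zero.1 h with h3 | h3
  · simpa [h1, h2] using h3
  · obtain ⟨i, hi⟩ := Function.ne_iff.1 hv
    obtain ⟨j, hj⟩ := Function.ne_iff.1 hw
    have := congrFun (congrFun h3 i) j
    rw [Matrix.vecMulVec_apply, Matrix.zero_apply] at this
    exact absurd this (mul_ne_zero hi hj)

/-- The block of $M$ along $v\otimes w$ has weight phase under `symp v`, since $w$ is orthogonal to
$v$ and `tilde v`, while an invariant $M$ has weight $1$. -/
theorem star_dotProduct_mulVec_eq_zero (hd : Even d) {M : Matrix (Fin d) (Fin d) ℂ}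
    (hM : ∀ S ∈ Sp d, S * M * S.transpose = M) {v w : Fin d → ℂ} (hv : v ≠ 0) (hw : w ≠ 0)
    (h : star w ⬝ᵥ v = 0) (h' : star w ⬝ᵥ tilde v = 0) : star v ⬝ᵥ M.mulVec (star w) = 0 := by
  have hS : symp v * M * (symp v).transpose = (1 : ℂ) • M := by
    rw [hM _ (symp_mem_Sp hd hv), one_smul]
  refine dotProduct_mulVec_eq_zero_of_proj hv hw
    (mul_mul_transpose_eq_zero hS (proj_mul_symp hd hv)
      (mul_symp_of_mul_proj (proj_mul_of_orthogonal h) (proj_mul_of_orthogonal h')) ?_)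
  intro h
  rw [phase, Complex.ext_iff] at h
  norm_num at h

/-- Uniqueness of the invariant alternating form: isotropic basis pairs kill all entries outside the
pairs $(k,\bar k)$, and isotropic sums equate the remaining ones up to sign. It makes $\Omega$ an
eigenvector of `act R`. -/
theorem exists_eq_smul_Omega (hd : Even d) (h0 : 0 < d) {M : Matrix (Fin d) (Fin d) ℂ}
    (hM : ∀ S ∈ Sp d, S * M * S.transpose = M) (hMt : M.transpose = -M) :
    ∃ c : ℂ, M = c • Omega d := by
  have hMt' (i j : Fin d) : M j i = -M i j := congrFun (congrFun hMt i) j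
  have hzero {i j : Fin d} (h : j ≠ bar i) : M i j = 0 := by
    by_cases hij : j = i
    · have := hMt' i i
      rw [hij]
      linear_combination (1 / 2) * this
    · have h1 := isotropic_e hd hij h
      have := star_dotProduct_mulVec_eq_zero hd hM h1.1 h1.2 (h1.symm hd).3
        (star_dotProduct_eq_zero_comm h1.4)
      rwa [star_e, star_e, e_dotProduct, e, Matrix.mulVec_single_one] at this
  have hconst (k l : Fin d) : sgn k * M k (bar k) = sgn l * M l (bar l) := by
    by_cases hlk : l = k
    · rw [hlk]
    by_cases hlk' : l = bar k
    · rw [hlk', bar_bar hd, sgn_bar hd, hMt' k (bar k)]; ring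
    have hkl' : k ≠ bar l := fun h => hlk' (by rw [h, bar_bar hd])
    have hkk := bar_ne hd k
    have hll := bar_ne hd l
    have hbb : bar k ≠ bar l := fun h => hlk (by rw [← bar_bar hd l, ← h, bar_bar hd])
    have hstar : star (sgn k • e (bar k) + (-sgn l) • e (bar l) : Fin d → ℂ)
        = sgn k • e (bar k) + (-sgn l) • e (bar l) := by
      simp [star_add, star_smul, star_e, star_sgn]
    have h1 := star_dotProduct_mulVec_eq_zero hd hM (v := e k + e l)
      (w := sgn k • e (bar k) + (-sgn l) • e (bar l)) (fun h => by
        have := congrFun h k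
        simp [e_apply, Ne.symm hlk] at this) (fun h => by
        have := congrFun h (bar k)
        simp [e_apply, hbb, sgn_ne_zero] at this) (by
        rw [hstar]
        simp [e_dotProduct, e_apply, hkk, hll, Ne.symm hlk', Ne.symm hkl']) (by
        rw [hstar, tilde, star_add, star_e, star_e, Matrix.mulVec_add, Omega_mulVec_e hd,
          Omega_mulVec_e hd]
        simp [e_dotProduct, e_apply, hbb, hbb.symm, sgn_mul_self])
    rw [hstar, star_add, star_e, star_e, Matrix.mulVec_add, Matrix.mulVec_smul, Matrix.mulVec_smul]
      at h1
    have hcol (m : Fin d) : M.mulVec (e m) = M.col m := Matrix.mulVec_single_one _ _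
    simp only [add_dotProduct, dotProduct_add, dotProduct_smul, hcol, e_dotProduct,
      Matrix.col_apply, hzero hbb, hzero hbb.symm, smul_eq_mul] at h1
    linear_combination h1
  refine ⟨sgn ⟨0, h0⟩ * M ⟨0, h0⟩ (bar ⟨0, h0⟩), ?_⟩
  ext i j
  rw [Matrix.smul_apply, Omega_apply hd, smul_eq_mul]
  split_ifs with h
  · rw [h, ← hconst i]
    linear_combination (-M i (bar i)) * sgn_mul_self i
  · rw [hzero h, mul_zero]

/-- Hermitian elements of the commutant of `S ⊗ S` are combinations of the identity, the flip and
the projection onto the invariant vector. -/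
theorem exists_eq_of_mem_InvSS (hd : Even d) (h4 : 4 ≤ d)
    {R : Matrix (Fin d × Fin d) (Fin d × Fin d) ℂ} (hR : R ∈ InvSS d) (hH : R.IsHermitian) :
    ∃ a b c : ℂ, R = a • 1 + b • flipOp d + c • omegaOp d := by
  have h0 : 0 < d := by omega
  obtain ⟨l, hl⟩ := exists_act_add_swap hd h0 hR
  obtain ⟨m, hm⟩ := exists_act_wedge_e hd h4 hR hH
  obtain ⟨κ, hκ⟩ := exists_eq_smul_Omega hd h0 (M := act R (Omega d))
    (fun S hS => by rw [← act_conj hR hS, Sp_mul_Omega_mul_transpose hd hS])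
    (by rw [← act_transpose hd h0 hR hH, Omega_transpose hd, map_neg])
  have hd' : (d : ℂ) ≠ 0 := by exact_mod_cast h0.ne'
  -- Block differences have eigenvalue $m$, so every block maps to $m$ times itself plus one common
  -- term $n\Omega$. Summing the $d$ blocks to $2\Omega$ gives $2\kappa=2m+dn$.
  set n : ℂ := 2 * (κ - m) / d with hn
  have hblock (k : Fin d) : act R (OmegaBlock k) = m • OmegaBlock k + n • Omega d := by
    have h1 (j : Fin d) : act R (OmegaBlock j)
        = act R (OmegaBlock k) + m • OmegaBlock j - m • OmegaBlock k := by
      have := act_OmegaBlock_sub hd h4 hR hH hm k j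
      rw [map_sub, smul_sub] at this
      linear_combination (norm := module) -this
    have h2 : act R ((2 : ℂ) • Omega d) = (d : ℂ) • act R (OmegaBlock k)
        + m • (2 : ℂ) • Omega d - (d : ℂ) • m • OmegaBlock k := by
      rw [← sum_OmegaBlock hd, map_sum, Finset.sum_congr rfl fun j _ => h1 j,
        Finset.sum_sub_distrib, Finset.sum_add_distrib, ← Finset.smul_sum]
      simp [Nat.cast_smul_eq_nsmul]
    rw [map_smul, hκ] at h2
    have h3 : (d : ℂ) • act R (OmegaBlock k)
        = (d : ℂ) • (m • OmegaBlock k + n • Omega d) := by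
      rw [smul_add, smul_smul _ n, hn, mul_div_cancel₀ _ hd']
      linear_combination (norm := module) -h2
    exact smul_right_injective _ hd' h3
  have hwedge (k j : Fin d) : act R (wedge (e k) (e j))
      = m • wedge (e k) (e j) + (n * Omega d k j) • Omega d := by
    by_cases h : j = bar k
    · have h1 : wedge (e k) (e j) = sgn k • OmegaBlock k := by
        rw [OmegaBlock, smul_smul, sgn_mul_self, one_smul, h]
      rw [h1, map_smul, hblock, Omega_apply hd, if_pos h]
      module
    · rw [hm k j h, Omega_apply hd, if_neg h, mul_zero, zero_smul, add_zero]
  -- Half the sum of the action on $E_{kp}+E_{pk}$ (eigenvalue $l$) and on $E_{kp}-E_{pk}$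
  -- (eigenvalue $m$ plus the $\Omega$ term).
  refine ⟨(l + m) / 2, (l - m) / 2, n / 2, ?_⟩
  ext ⟨i, j⟩ ⟨k, p⟩
  have hE : wedge (e k) (e p) = Matrix.single k p (1 : ℂ) - Matrix.single p k 1 := by
    rw [wedge, e, e, ← Matrix.single_eq_single_vecMulVec_single,
      ← Matrix.single_eq_single_vecMulVec_single]
  have h1 := congrFun (congrFun (hl k p) i) j
  have h2 := congrFun (congrFun (hwedge k p) i) j
  rw [hE, map_sub] at h2
  rw [map_add] at h1
  simp only [Matrix.add_apply, Matrix.sub_apply, Matrix.smul_apply, act_single, smul_eq_mul,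
    Matrix.single_apply] at h1 h2
  simp only [Matrix.add_apply, Matrix.smul_apply, smul_eq_mul, Matrix.one_apply, flipOp, omegaOp,
    Matrix.of_apply, Prod.mk.injEq]
  have e1 : (if i = k ∧ j = p then (1 : ℂ) else 0) = if k = i ∧ p = j then 1 else 0 := by
    simp only [eq_comm]
  have e2 : (if i = p ∧ j = k then (1 : ℂ) else 0) = if p = i ∧ k = j then 1 else 0 := by
    simp only [eq_comm]
  rw [e1, e2]
  linear_combination (1 / 2) * h1 + (1 / 2) * h2

/-! ### Twirling over the symplectic group -/

theorem isCompact_Sp (d : ℕ) : IsCompact (Sp d) := by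
  have hb : IsCompact (Set.pi Set.univ fun _ : Fin d => Set.pi Set.univ fun _ : Fin d =>
      Metric.closedBall (0 : ℂ) 1) :=
    isCompact_univ_pi fun _ => isCompact_univ_pi fun _ => isCompact_closedBall _ _
  have hSp : Sp d = {S : Matrix (Fin d) (Fin d) ℂ | S * star S = 1} ∩
      {S | S.transpose * Omega d * S = Omega d} := by
    ext S
    simp only [Sp, Set.mem_ofPred_eq, Set.mem_inter_iff, Matrix.mem_unitaryGroup_iff]
  refine hb.of_isClosed_subset ?_ ?_
  · rw [hSp]
    refine (isClosed_eq ?_ continuous_const).inter (isClosed_eq ?_ continuous_const)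
    · exact continuous_id.matrix_mul continuous_id.matrix_conjTranspose
    · exact (continuous_id.matrix_transpose.matrix_mul continuous_const).matrix_mul continuous_id
  · intro S hS i _ j _
    rw [mem_closedBall_zero_iff]
    exact entry_norm_bound_of_unitary hS.1 i j

theorem mul_mem_Sp {S T : Matrix (Fin d) (Fin d) ℂ} (hS : S ∈ Sp d) (hT : T ∈ Sp d) :
    S * T ∈ Sp d := by
  refine ⟨mul_mem hS.1 hT.1, ?_⟩
  calc _ = T.transpose * (S.transpose * Omega d * S) * T := by
        rw [Matrix.transpose_mul]; simp only [Matrix.mul_assoc]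
    _ = _ := by rw [hS.2, hT.2]

theorem one_mem_Sp (d : ℕ) : (1 : Matrix (Fin d) (Fin d) ℂ) ∈ Sp d :=
  ⟨one_mem _, by simp⟩

theorem trace_mul_conj_of_mem_InvSS {L : Matrix (Fin d × Fin d) (Fin d × Fin d) ℂ}
    (hL : L ∈ InvSS d) {S : Matrix (Fin d) (Fin d) ℂ} (hS : S ∈ Sp d)
    (X : Matrix (Fin d × Fin d) (Fin d × Fin d) ℂ) :
    (L * ((S ⊗ₖ S) * X * (S ⊗ₖ S).conjTranspose)).trace = (L * X).trace := by
  have hU : (S ⊗ₖ S).conjTranspose * (S ⊗ₖ S) = 1 :=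
    Matrix.mem_unitaryGroup_iff'.1 (kronecker_mem_unitaryGroup hS.1 hS.1)
  conv_lhs => rw [← hL S hS]
  calc _ = ((S ⊗ₖ S) * (L * (((S ⊗ₖ S).conjTranspose * (S ⊗ₖ S)) *
        (X * (S ⊗ₖ S).conjTranspose)))).trace := by simp only [Matrix.mul_assoc]
    _ = (L * X * ((S ⊗ₖ S).conjTranspose * (S ⊗ₖ S))).trace := by
        rw [hU, Matrix.one_mul, Matrix.trace_mul_comm, ← Matrix.mul_assoc, Matrix.mul_assoc, hU]
    _ = _ := by rw [hU, Matrix.mul_one]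

theorem flipOp_conjTranspose : (flipOp d).conjTranspose = flipOp d := by
  ext p q
  simp only [flipOp, Matrix.conjTranspose_apply, Matrix.of_apply, apply_ite star, star_one,
    star_zero]
  refine if_congr ⟨fun h => ⟨h.2.symm, h.1.symm⟩, fun h => ⟨h.2.symm, h.1.symm⟩⟩ rfl rfl

theorem exists_real_eq_of_mem_InvSS (hd : Even d) (h4 : 4 ≤ d)
    {R : Matrix (Fin d × Fin d) (Fin d × Fin d) ℂ} (hR : R ∈ InvSS d) (hH : R.IsHermitian) :
    ∃ x y z : ℝ, R = (x : ℂ) • 1 + (y : ℂ) • omegaOp d + (z : ℂ) • flipOp d := by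
  obtain ⟨a, b, c, h⟩ := exists_eq_of_mem_InvSS hd h4 hR hH
  refine ⟨a.re, c.re, b.re, ?_⟩
  have h' : R = star a • 1 + star b • flipOp d + star c • omegaOp d := by
    rw [← hH.eq, h]
    simp only [Matrix.conjTranspose_add, Matrix.conjTranspose_smul, Matrix.conjTranspose_one,
      flipOp_conjTranspose, omegaOp_conjTranspose hd]
  have hre (w : ℂ) : (w.re : ℂ) = (1 / 2) * w + (1 / 2) * star w := by
    apply Complex.ext <;> simp
    ring
  -- Averaging the expansion with its adjoint replaces the coefficients by their real parts, since
  -- all three operators are Hermitian.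
  rw [hre, hre, hre]
  linear_combination (norm := module) (1 / 2 : ℂ) • h + (1 / 2 : ℂ) • h'

/-- Twirling a pure state over `Sp(d)` shows that the invariant state with the same expectations
lies in the same Schmidt class. -/
theorem sig_mem_schmidtSet (hd : Even d) (h4 : 4 ≤ d) {k r : ℕ} (hr : r ≤ k)
    {ξ : EuclideanSpace ℂ (Fin d × Fin d)} (hξ : ‖ξ‖ = 1) (h : HasSchmidtRank ξ r) {a b : ℝ}
    (hx : omegaVal (ketBra ξ) = omegaVal (sig d a b))
    (hy : flipVal (ketBra ξ) = flipVal (sig d a b)) : sig d a b ∈ schmidtSet (Fin d) (Fin d) k := by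
  have h0 : d ≠ 0 := by omega
  let f : Matrix (Fin d) (Fin d) ℂ → Matrix (Fin d × Fin d) (Fin d × Fin d) ℂ :=
    fun S => (S ⊗ₖ S) * ketBra ξ * (S ⊗ₖ S).conjTranspose
  have hf : Continuous f := by
    have h1 : Continuous fun S : Matrix (Fin d) (Fin d) ℂ => S ⊗ₖ S :=
      continuous_matrix fun p q =>
        (continuous_id.matrix_elem p.1 q.1).mul (continuous_id.matrix_elem p.2 q.2)
    exact (h1.matrix_mul continuous_const).matrix_mul h1.matrix_conjTranspose
  obtain ⟨R, hR, hinv⟩ := exists_invariant_mem_convexHull ((isCompact_Sp d).image hf)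
    ⟨_, 1, one_mem_Sp d, rfl⟩ (G := (fun S => S ⊗ₖ S) '' Sp d)
    (by
      rintro _ ⟨S, hS, rfl⟩
      exact Matrix.mem_unitaryGroup_iff'.1 (kronecker_mem_unitaryGroup hS.1 hS.1))
    (by
      rintro _ ⟨S, hS, rfl⟩ _ ⟨T, hT, rfl⟩
      refine ⟨S * T, mul_mem_Sp hS hT, ?_⟩
      simp only [f, Matrix.mul_kronecker_mul, Matrix.conjTranspose_mul, Matrix.mul_assoc])
  have hpure : ketBra ξ ∈ schmidtSet (Fin d) (Fin d) k :=
    subset_convexHull ℝ _ ⟨ξ, hξ, ⟨r, hr, h⟩, rfl⟩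
  have hRk : R ∈ schmidtSet (Fin d) (Fin d) k := by
    refine convexHull_min ?_ (convex_convexHull ℝ _) hR
    rintro _ ⟨S, hS, rfl⟩
    exact conj_mem_schmidtSet hS.1 hS.1 hpure
  have hRs := isState_of_mem_schmidtSet hRk
  -- Both observables are invariant, so their expectations are constant on the orbit of $\xi$ and
  -- hence on its convex hull.
  have hval : omegaVal R = omegaVal (sig d a b) ∧ flipVal R = flipVal (sig d a b) := by
    have hc : Convex ℝ {ρ : Matrix (Fin d × Fin d) (Fin d × Fin d) ℂ |
        omegaVal ρ = omegaVal (sig d a b) ∧ flipVal ρ = flipVal (sig d a b)} := by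
      rintro ρ ⟨h1, h2⟩ σ ⟨h3, h4⟩ s t hs ht hst
      refine ⟨?_, ?_⟩
      · rw [omegaVal_lin, h1, h3, ← add_mul, hst, one_mul]
      · rw [flipVal_lin, h2, h4, ← add_mul, hst, one_mul]
    refine convexHull_min ?_ hc hR
    rintro _ ⟨S, hS, rfl⟩
    refine ⟨?_, ?_⟩
    · rw [← hx, omegaVal, trace_mul_conj_of_mem_InvSS (omegaOp_mem_InvSS hd) hS, omegaVal]
    · rw [← hy, flipVal, trace_mul_conj_of_mem_InvSS flipOp_mem_InvSS hS, flipVal]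
  obtain ⟨x, y, z, hxyz⟩ := exists_real_eq_of_mem_InvSS hd h4
    (R := R) (fun S hS => hinv _ ⟨S, hS, rfl⟩) hRs.1.isHermitian
  have hd0 : (4 : ℝ) ≤ d := by exact_mod_cast h4
  obtain ⟨e1, e2⟩ := hval
  have e3 := hRs.2
  rw [hxyz, sig, omegaVal_comb hd, omegaVal_comb hd] at e1
  rw [hxyz, sig, flipVal_comb hd, flipVal_comb hd] at e2
  rw [hxyz, trace_comb hd] at e3
  have e3' : x * d ^ 2 + y * d + z * d
      = (1 - a - b) / d ^ 2 * d ^ 2 + a / d * d + b / d * d := by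
    rw [div_mul_cancel₀ _ (by positivity), div_mul_cancel₀ _ (by positivity),
      div_mul_cancel₀ _ (by positivity)]
    have : x * d ^ 2 + y * d + z * d = 1 := by exact_mod_cast e3
    linear_combination this
  have hyz : y - a / d = z - b / d := by
    have : (d * (d + 1) : ℝ) * (y - a / d) = (d * (d + 1)) * (z - b / d) := by
      linear_combination e1 - e2
    exact mul_left_cancel₀ (by positivity) this
  have hy0 : y = a / d := by
    -- Trace and the two expectations determine the coefficients except when $d=2$, where $I-F$
    -- equals `omegaOp`; hence the factor $d-2$.
    have h5 : (d * (d - 2) * (d + 1) : ℝ) * (y - a / d) = 0 := by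
      linear_combination d * e1 - e3' - (d ^ 2 + d : ℝ) * hyz
    have h6 : (d * (d - 2) * (d + 1) : ℝ) ≠ 0 :=
      mul_ne_zero (mul_ne_zero (by positivity) (by linarith)) (by positivity)
    exact sub_eq_zero.1 ((mul_eq_zero.1 h5).resolve_left h6)
  have hz0 : z = b / d := by linear_combination -hyz + hy0
  have hx0 : x = (1 - a - b) / d ^ 2 := by
    rw [← hy0, ← hz0] at e3'
    exact mul_right_cancel₀ (b := (d : ℝ) ^ 2) (by positivity) (by linear_combination e3')
  rw [sig, ← hx0, ← hy0, ← hz0, ← hxyz]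
  exact hRk

/-! ### Vectors saturating the witness -/

theorem norm_eq_one_of_sum {ι : Type*} [Fintype ι] {ξ : EuclideanSpace ℂ ι}
    (h : ∑ i, Complex.normSq (ξ i) = 1) : ‖ξ‖ = 1 := by
  rw [EuclideanSpace.norm_eq, Real.sqrt_eq_one]
  simpa only [Complex.normSq_eq_norm_sq] using h

theorem sum_ite_lt {k : ℕ} (hk : k ≤ d) {M : Type*} [Semiring M] (x : M) :
    ∑ i : Fin d, (if (i : ℕ) < k then x else 0) = k * x := by
  rw [← Finset.sum_filter, Finset.sum_const, Fin.card_filter_val_lt, min_eq_right hk,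
    nsmul_eq_mul]

/-- The vector `k^{-1/2} ∑_{i<k} e_i ⊗ (p e_i + q e_{i + d/2})`. -/
noncomputable def pairVec (d k : ℕ) (p q : ℝ) : EuclideanSpace ℂ (Fin d × Fin d) :=
  WithLp.toLp 2 fun x => if (x.1 : ℕ) < k then
    ((1 / √(k : ℝ) : ℝ) : ℂ) * ((if x.2 = x.1 then (p : ℂ) else 0)
      + if x.2 = bar x.1 then (q : ℂ) else 0) else 0

theorem pairVec_apply (k : ℕ) (p q : ℝ) (i j : Fin d) :
    pairVec d k p q (i, j) = if (i : ℕ) < k then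
      ((1 / √(k : ℝ) : ℝ) : ℂ) * ((if j = i then (p : ℂ) else 0)
        + if j = bar i then (q : ℂ) else 0) else 0 := rfl

theorem bar_ne_of_lt {i j : Fin d} (hi : (i : ℕ) < d / 2) (hj : (j : ℕ) < d / 2) : bar i ≠ j := by
  intro h
  rw [Fin.ext_iff, bar_val, if_pos hi] at h
  omega

theorem inv_sqrt_mul_self {k : ℕ} (hk : 0 < k) : (k : ℝ) * ((1 / √(k : ℝ)) * (1 / √(k : ℝ))) = 1 := by
  rw [div_mul_div_comm, Real.mul_self_sqrt (Nat.cast_nonneg k)]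
  have : (k : ℝ) ≠ 0 := by exact_mod_cast hk.ne'
  field_simp

theorem norm_pairVec (hd : Even d) {k : ℕ} (hk : 0 < k) (hkd : k ≤ d / 2) {p q : ℝ}
    (hpq : p ^ 2 + q ^ 2 = 1) : ‖pairVec d k p q‖ = 1 := by
  apply norm_eq_one_of_sum
  rw [Fintype.sum_prod_type]
  have h (i : Fin d) : ∑ j, Complex.normSq (pairVec d k p q (i, j))
      = if (i : ℕ) < k then (1 / √(k : ℝ)) * (1 / √(k : ℝ)) else 0 := by
    simp only [pairVec_apply]
    split_ifs with hi
    · have hb := bar_ne hd i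
      have hs (j : Fin d) : Complex.normSq (((1 / √(k : ℝ) : ℝ) : ℂ)
          * ((if j = i then (p : ℂ) else 0) + if j = bar i then (q : ℂ) else 0))
          = (1 / √(k : ℝ)) * (1 / √(k : ℝ)) *
            ((if j = i then p ^ 2 else 0) + if j = bar i then q ^ 2 else 0) := by
        rw [Complex.normSq_mul, Complex.normSq_ofReal]
        congr 1
        by_cases h1 : j = i
        · have h2 : j ≠ bar i := by rw [h1]; exact hb.symm
          rw [if_pos h1, if_neg h2, if_pos h1, if_neg h2, add_zero, add_zero,
            Complex.normSq_ofReal, sq]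
        · by_cases h2 : j = bar i
          · rw [if_neg h1, if_pos h2, if_neg h1, if_pos h2, zero_add, zero_add,
              Complex.normSq_ofReal, sq]
          · simp [h1, h2]
      simp only [hs, ← Finset.mul_sum, Finset.sum_add_distrib, Finset.sum_ite_eq',
        Finset.mem_univ, if_true, hpq, mul_one]
    · simp
  simp only [h]
  rw [sum_ite_lt (by omega), inv_sqrt_mul_self hk]

/-- The $k$ overlaps with $\Omega$ all have the same sign and add coherently to $\sqrt k\,q$. -/
theorem omegaVal_pairVec (hd : Even d) {k : ℕ} (hk : 0 < k) (hkd : k ≤ d / 2) (p q : ℝ) :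
    omegaVal (ketBra (pairVec d k p q)) = k * q ^ 2 := by
  rw [omegaVal_ketBra hd, Fintype.sum_prod_type]
  have h (i : Fin d) : ∑ j, Omega d i j * pairVec d k p q (i, j)
      = if (i : ℕ) < k then (((1 / √(k : ℝ)) * q : ℝ) : ℂ) else 0 := by
    simp only [pairVec_apply, Omega_apply hd, ite_mul, zero_mul, Finset.sum_ite_eq',
      Finset.mem_univ, if_true, bar_ne hd i, if_false, zero_add]
    split_ifs with hi
    · rw [sgn, if_pos (by omega)]; push_cast; ring
    · simp
  simp only [h]
  rw [sum_ite_lt (by omega), Complex.normSq_mul, Complex.normSq_ofReal, Complex.normSq_natCast]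
  linear_combination (k * q ^ 2 : ℝ) * inv_sqrt_mul_self hk

/-- All first indices lie below $d/2$ and all partners at or above it, so only the diagonal part $p$
survives the flip. -/
theorem flipVal_pairVec {k : ℕ} (hk : 0 < k) (hkd : k ≤ d / 2) (p q : ℝ) :
    flipVal (ketBra (pairVec d k p q)) = p ^ 2 := by
  rw [flipVal_ketBra, Fintype.sum_prod_type]
  have h (i : Fin d) : ∑ j, (pairVec d k p q (j, i) * star (pairVec d k p q (i, j))).re
      = if (i : ℕ) < k then (1 / √(k : ℝ)) * (1 / √(k : ℝ)) * p ^ 2 else 0 := by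
    rw [Finset.sum_eq_single i]
    · rw [pairVec_apply]
      by_cases hi : (i : ℕ) < k
      · rw [if_pos hi, if_pos hi, if_pos rfl,
          if_neg (bar_ne_of_lt (by omega) (by omega)).symm, add_zero,
          Complex.star_def, map_mul, Complex.conj_ofReal, Complex.conj_ofReal]
        simp only [← Complex.ofReal_mul, Complex.ofReal_re]
        ring
      · rw [if_neg hi, if_neg hi, zero_mul, Complex.zero_re]
    · intro j _ hji
      rw [pairVec_apply, pairVec_apply]
      by_cases hi : (i : ℕ) < k
      · by_cases hj : (j : ℕ) < k
        · have hji' : j ≠ bar i := (bar_ne_of_lt (by omega) (by omega)).symm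
          simp [hi, hji, hji']
        · rw [if_neg hj]; simp
      · rw [if_neg hi]; simp
    · simp
  simp only [Prod.swap, h]
  rw [sum_ite_lt (by omega)]
  linear_combination (p ^ 2 : ℝ) * inv_sqrt_mul_self hk

/-- The bound $k\le d/2$ keeps the index pairs $\{i,\bar i\}$ disjoint, so the unit vectors
$p\,e_i+q\,e_{\bar i}$ are orthonormal. -/
theorem hasSchmidtRank_pairVec (hd : Even d) {k : ℕ} (hk : 0 < k) (hkd : k ≤ d / 2) {p q : ℝ}
    (hpq : p ^ 2 + q ^ 2 = 1) : HasSchmidtRank (pairVec d k p q) k := by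
  have hkd' : k ≤ d := by omega
  let u : Fin k → Fin d := Fin.castLE hkd'
  have hu : Function.Injective u := Fin.castLE_injective hkd'
  have hul (l : Fin k) : (u l : ℕ) < d / 2 := lt_of_lt_of_le l.2 hkd
  refine ⟨fun _ => 1 / √(k : ℝ), fun l => EuclideanSpace.single (u l) 1, fun l =>
    EuclideanSpace.single (u l) (p : ℂ) + EuclideanSpace.single (bar (u l)) (q : ℂ), fun _ => ?_,
    ?_, ?_, fun i j => ?_⟩
  · have : (0 : ℝ) < k := by exact_mod_cast hk
    positivity
  · exact (EuclideanSpace.orthonormal_single (𝕜 := ℂ) (ι := Fin d)).comp u hu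
  · rw [orthonormal_iff_ite]
    intro l m
    have hbb : bar (u l) = bar (u m) ↔ l = m :=
      ⟨fun h => hu (by rw [← bar_bar hd (u l), h, bar_bar hd]), fun h => by rw [h]⟩
    have h1 := bar_ne_of_lt (hul l) (hul m)
    have h2 := (bar_ne_of_lt (hul m) (hul l)).symm
    simp only [inner_add_left, EuclideanSpace.inner_single_left, PiLp.add_apply,
      PiLp.single_apply, hbb, hu.eq_iff, h1, h2, if_false, add_zero, zero_add,
      Complex.conj_ofReal]
    split_ifs
    · have : ((p ^ 2 + q ^ 2 : ℝ) : ℂ) = 1 := by rw [hpq, Complex.ofReal_one]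
      rw [← this]; push_cast; ring
    · simp
  · rw [pairVec_apply]
    by_cases hi : (i : ℕ) < k
    · rw [if_pos hi, Finset.sum_eq_single ⟨i, hi⟩]
      · have : u ⟨i, hi⟩ = i := rfl
        simp only [this, PiLp.add_apply, PiLp.single_apply, if_true, mul_one]
      · intro l _ hl
        have : i ≠ u l := fun h => hl (by ext; simp [h, u])
        simp [this]
      · simp
    · rw [if_neg hi]
      refine (Finset.sum_eq_zero fun l _ => ?_).symm
      have : i ≠ u l := fun h => hi (by rw [h]; exact l.2)
      simp [this]

/-! ### Schmidt numbers in the family `sig` -/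

theorem sig_mem_schmidtSet_of_line (hd : Even d) (h4 : 4 ≤ d) {k : ℕ} (hk : 0 < k)
    (hkd : k ≤ d / 2) {a b t : ℝ} (ht : 0 ≤ t) (ht' : t ≤ 1) (hx : omegaVal (sig d a b) = k * t)
    (hy : flipVal (sig d a b) = 1 - t) : sig d a b ∈ schmidtSet (Fin d) (Fin d) k := by
  have hp : √(1 - t) ^ 2 = 1 - t := Real.sq_sqrt (by linarith)
  have hq : √t ^ 2 = t := Real.sq_sqrt ht
  have hpq : √(1 - t) ^ 2 + √t ^ 2 = 1 := by rw [hp, hq]; ring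
  refine sig_mem_schmidtSet hd h4 le_rfl (norm_pairVec hd hk hkd hpq)
    (hasSchmidtRank_pairVec hd hk hkd hpq) ?_ ?_
  · rw [omegaVal_pairVec hd hk hkd, hq, hx]
  · rw [flipVal_pairVec hk hkd, hp, hy]

/-- On this line the witness for $k$ is an equality, and $t>0$ makes the witness for $k-1$ fail. -/
theorem schmidtNumber_sig_of_line (hd : Even d) (h4 : 4 ≤ d) {k : ℕ} (hk : 0 < k)
    (hkd : k ≤ d / 2) {a b t : ℝ} (ht : 0 < t) (ht' : t ≤ 1) (hx : omegaVal (sig d a b) = k * t)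
    (hy : flipVal (sig d a b) = 1 - t) : schmidtNumber (sig d a b) = k := by
  refine schmidtNumber_eq hd (sig_mem_schmidtSet_of_line hd h4 hk hkd ht.le ht' hx hy) ?_ ?_
  · linarith
  · rw [hx, hy]; linarith

/-- The point of the invariant family where both expectations vanish is separable. -/
theorem sig_mem_schmidtSet_of_zero (hd : Even d) (h4 : 4 ≤ d) {k : ℕ} (hk : 0 < k) {a b : ℝ}
    (hx : omegaVal (sig d a b) = 0) (hy : flipVal (sig d a b) = 0) :
    sig d a b ∈ schmidtSet (Fin d) (Fin d) k := by
  let i : Fin d := ⟨0, by omega⟩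
  let j : Fin d := ⟨1, by omega⟩
  have hij : i ≠ j := by simp [i, j]
  have hbar : j ≠ bar i := (bar_ne_of_lt (by simp only [i]; omega) (by simp only [j]; omega)).symm
  -- The product vector $e_0\otimes e_1$ has both expectations zero: since $d\ge4$, index $1$ is
  -- neither $0$ nor its partner $d/2$.
  refine sig_mem_schmidtSet hd h4 (ξ := EuclideanSpace.single (i, j) 1) hk (by simp)
    ⟨fun _ => 1, fun _ => EuclideanSpace.single i 1, fun _ => EuclideanSpace.single j 1,
      fun _ => one_pos, ?_, ?_, fun x y => ?_⟩ ?_ ?_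
  · exact (EuclideanSpace.orthonormal_single (𝕜 := ℂ) (ι := Fin d)).comp (fun _ : Fin 1 => i)
      (Function.injective_of_subsingleton _)
  · exact (EuclideanSpace.orthonormal_single (𝕜 := ℂ) (ι := Fin d)).comp (fun _ : Fin 1 => j)
      (Function.injective_of_subsingleton _)
  · by_cases h1 : x = i <;> by_cases h2 : y = j <;> simp [h1, h2]
  · rw [omegaVal_ketBra hd, hx, Finset.sum_eq_single (i, j)]
    · simp [Omega_apply hd, hbar]
    · intro b _ hb
      simp [hb]
    · simp
  · rw [flipVal_ketBra, hy]
    refine Finset.sum_eq_zero fun p _ => ?_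
    by_cases h : p = (i, j)
    · simp [h, hij]
    · simp [h]

theorem omegaVal_sig_self (hd : Even d) (h0 : d ≠ 0) (a : ℝ) :
    omegaVal (sig d a a) = (1 + a * (d ^ 2 - d - 2)) / d := by
  rw [omegaVal_sig hd h0]; field_simp; ring

theorem flipVal_sig_self (hd : Even d) (h0 : d ≠ 0) (a : ℝ) :
    flipVal (sig d a a) = (1 + a * (d ^ 2 - d - 2)) / d := by
  rw [flipVal_sig hd h0]; field_simp; ring

/-- The diagonal $a=b$ is a segment affine in $a$. It is enough to place its two ends in the class:
the point at $1/(d+2)$ on the line for $d/2$, and the separable point where both expectations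
vanish. -/
theorem sig_self_mem_schmidtSet (hd : Even d) (h4 : 4 ≤ d) {a : ℝ}
    (ha : ((d : ℝ) - 3) / ((d : ℝ) ^ 2 - d - 2) < a) (ha' : a ≤ 1 / ((d : ℝ) + 2)) :
    sig d a a ∈ schmidtSet (Fin d) (Fin d) (d / 2) := by
  have h0 : d ≠ 0 := by omega
  have hd4 : (4 : ℝ) ≤ d := by exact_mod_cast h4
  have hD : (0 : ℝ) < d ^ 2 - d - 2 := by nlinarith
  have hn : ((d / 2 : ℕ) : ℝ) = d / 2 := by
    rw [Nat.cast_div hd.two_dvd (by norm_num)]; norm_num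
  have hapos : 0 < a := lt_of_le_of_lt (div_nonneg (by linarith) hD.le) ha
  have h1 : sig d (1 / (d + 2)) (1 / (d + 2)) ∈ schmidtSet (Fin d) (Fin d) (d / 2) := by
    refine sig_mem_schmidtSet_of_line hd h4 (by omega) le_rfl (t := 2 / (d + 2)) (by positivity)
      ((div_le_one (by positivity)).2 (by linarith)) ?_ ?_
    · rw [omegaVal_sig_self hd h0, hn]
      field_simp
      ring
    · rw [flipVal_sig_self hd h0]
      field_simp
      ring
  -- The zero of the common expectation $(1+a(d^2-d-2))/d$.
  set a₀ : ℝ := -1 / (d ^ 2 - d - 2) with ha₀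
  have h2 : sig d a₀ a₀ ∈ schmidtSet (Fin d) (Fin d) (d / 2) := by
    have : (1 + a₀ * (d ^ 2 - d - 2)) / d = 0 := by
      rw [ha₀, div_mul_cancel₀ _ hD.ne']; simp
    refine sig_mem_schmidtSet_of_zero hd h4 (by omega) ?_ ?_
    · rw [omegaVal_sig_self hd h0, this]
    · rw [flipVal_sig_self hd h0, this]
  have ha₀' : a₀ < 0 := div_neg_of_neg_of_pos (by norm_num) hD
  set g : ℝ := 1 / (d + 2) with hg
  have hgpos : 0 < g := by positivity
  have hlen : 0 < g - a₀ := by linarith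
  have hconv := (convex_convexHull ℝ _) h2 h1 (a := (g - a) / (g - a₀)) (b := (a - a₀) / (g - a₀))
    (div_nonneg (by linarith) hlen.le) (div_nonneg (by linarith) hlen.le)
    (by field_simp; ring)
  have heq : ((g - a) / (g - a₀)) • sig d a₀ a₀ + ((a - a₀) / (g - a₀)) • sig d g g
      = sig d a a := by
    have hne : ((g : ℂ) - a₀) ≠ 0 := by exact_mod_cast hlen.ne'
    ext p q
    simp only [sig, Matrix.add_apply, Matrix.smul_apply, smul_eq_mul, Complex.real_smul]
    push_cast
    field_simp
    ring
  rwa [heq] at hconv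

/-- With common expectation $s$, the witness for $d/2-1$ fails exactly when $s>(d-2)/d$, which is
the stated lower bound on $a$. -/
theorem schmidtNumber_sig_self (hd : Even d) (h4 : 4 ≤ d) {a : ℝ}
    (ha : ((d : ℝ) - 3) / ((d : ℝ) ^ 2 - d - 2) < a) (ha' : a ≤ 1 / ((d : ℝ) + 2)) :
    schmidtNumber (sig d a a) = d / 2 := by
  have h0 : d ≠ 0 := by omega
  have hd4 : (4 : ℝ) ≤ d := by exact_mod_cast h4
  have hD : (0 : ℝ) < d ^ 2 - d - 2 := by nlinarith
  have hn : ((d / 2 : ℕ) : ℝ) = d / 2 := by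
    rw [Nat.cast_div hd.two_dvd (by norm_num)]; norm_num
  have h1 : (d : ℝ) - 3 < a * (d ^ 2 - d - 2) := (div_lt_iff₀ hD).1 ha
  have h2 : a * (d ^ 2 - d - 2) ≤ d - 1 := by
    have := mul_le_mul_of_nonneg_right ha' hD.le
    refine this.trans ?_
    rw [one_div_mul_eq_div, div_le_iff₀ (by positivity)]
    nlinarith
  refine schmidtNumber_eq hd (sig_self_mem_schmidtSet hd h4 ha ha') ?_ ?_
  · rw [flipVal_sig_self hd h0, div_le_one (by positivity)]
    linarith
  · rw [flipVal_sig_self hd h0, omegaVal_sig_self hd h0, hn, ← sub_pos]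
    have : (1 + a * (d ^ 2 - d - 2)) / d - (d / 2 - 1) * (1 - (1 + a * (d ^ 2 - d - 2)) / d)
        = (a * (d ^ 2 - d - 2) - (d - 3)) / 2 := by
      field_simp
      ring
    rw [this]
    linarith

/-- The parameters put `sig d a b` on the line for $d/2$ at $t=1/(d-1)$ and `sig d b a` on the line
for $2$ at $t=(d-2)/(2(d-1))$. -/
theorem gap_values (hd : Even d) (h4 : 4 ≤ d) {a b : ℝ} (ha : a = 1 / (2 * d - 2))
    (hb : b = (2 * d - 3) / (2 * d ^ 2 - 2)) :
    sig d a b ∈ schmidtSet (Fin d) (Fin d) (d / 2) ∧ sig d b a ∈ schmidtSet (Fin d) (Fin d) 2 ∧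
      schmidtNumber (sig d a b) = d / 2 ∧ schmidtNumber (sig d b a) = 2 := by
  have h0 : d ≠ 0 := by omega
  have hd4 : (4 : ℝ) ≤ d := by exact_mod_cast h4
  have hd0 : (d : ℝ) ≠ 0 := by positivity
  have hd1 : (d : ℝ) - 1 ≠ 0 := by linarith
  have hd2 : (d : ℝ) + 1 ≠ 0 := by linarith
  have hn : ((d / 2 : ℕ) : ℝ) = d / 2 := by
    rw [Nat.cast_div hd.two_dvd (by norm_num)]; norm_num
  have ha' : a = 1 / (2 * (d - 1)) := by rw [ha]; ring
  have hb' : b = (2 * d - 3) / (2 * ((d - 1) * (d + 1))) := by rw [hb]; ring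
  have x1 : omegaVal (sig d a b) = (d / 2 : ℕ) * (1 / ((d : ℝ) - 1)) := by
    rw [omegaVal_sig hd h0, hn, ha', hb']; field_simp; ring
  have y1 : flipVal (sig d a b) = 1 - 1 / ((d : ℝ) - 1) := by
    rw [flipVal_sig hd h0, ha', hb']; field_simp; ring
  have x2 : omegaVal (sig d b a) = (2 : ℕ) * (((d : ℝ) - 2) / (2 * (d - 1))) := by
    rw [omegaVal_sig hd h0, ha', hb']; field_simp; ring
  have y2 : flipVal (sig d b a) = 1 - ((d : ℝ) - 2) / (2 * (d - 1)) := by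
    rw [flipVal_sig hd h0, ha', hb']; field_simp; ring
  have t1 : 0 < 1 / ((d : ℝ) - 1) := div_pos one_pos (by linarith)
  have t1' : 1 / ((d : ℝ) - 1) ≤ 1 := (div_le_one (by linarith)).2 (by linarith)
  have t2 : 0 < ((d : ℝ) - 2) / (2 * (d - 1)) := div_pos (by linarith) (by linarith)
  have t2' : ((d : ℝ) - 2) / (2 * (d - 1)) ≤ 1 := (div_le_one (by linarith)).2 (by linarith)
  exact ⟨sig_mem_schmidtSet_of_line hd h4 (by omega) le_rfl t1.le t1' x1 y1,
    sig_mem_schmidtSet_of_line hd h4 (by omega) (by omega) t2.le t2' x2 y2,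
    schmidtNumber_sig_of_line hd h4 (by omega) le_rfl t1 t1' x1 y1,
    schmidtNumber_sig_of_line hd h4 (by omega) (by omega) t2 t2' x2 y2⟩

/-! ### Transfer to `rho` and conclusion -/

theorem schmidtNumber_rho (hd : Even d) (h0 : d ≠ 0) (a b : ℝ) :
    schmidtNumber (rho d a b) = schmidtNumber (sig d a b) := by
  rw [← conj_sig hd h0, schmidtNumber_conj (one_mem _) (Omega_mem_unitaryGroup hd)]

theorem rho_mem_schmidtSet (hd : Even d) (h0 : d ≠ 0) {a b : ℝ} {k : ℕ}
    (h : sig d a b ∈ schmidtSet (Fin d) (Fin d) k) :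
    rho d a b ∈ schmidtSet (Fin d) (Fin d) k := by
  rw [← conj_sig hd h0]
  exact conj_mem_schmidtSet (one_mem _) (Omega_mem_unitaryGroup hd) h

end SympState

theorem mainTheorem10 (d : ℕ) (hd : 4 ≤ d) (hd2 : Even d) :
    -- part 1: Schmidt number gap between a PPT state and its partial transpose
    ((∃ ρ ∈ InvSSbar d, IsPPT ρ ∧
        (schmidtNumber ρ : ℤ) - (schmidtNumber (partialTranspose ρ) : ℤ) = (d : ℤ) / 2 - 2) ∧
      (∃ ρ ∈ InvSS d, IsPPT ρ ∧
        (schmidtNumber ρ : ℤ) - (schmidtNumber (partialTranspose ρ) : ℤ) = (d : ℤ) / 2 - 2) ∧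
      (∀ ρ, ρ = rho d (1 / (2 * d - 2)) ((2 * d - 3) / (2 * d ^ 2 - 2)) →
        ρ ∈ InvSSbar d ∧ IsPPT ρ ∧
          schmidtNumber ρ = d / 2 ∧ schmidtNumber (partialTranspose ρ) = 2)) ∧
    -- part 2: states that are local-unitary equivalent to their partial transpose
    ((∃ ρ ∈ InvSSbar d, IsState ρ ∧ LocalUnitaryEquiv ρ (partialTranspose ρ) ∧
        schmidtNumber ρ = d / 2) ∧
      (∃ ρ ∈ InvSS d, IsState ρ ∧ LocalUnitaryEquiv ρ (partialTranspose ρ) ∧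
        schmidtNumber ρ = d / 2) ∧
      (∀ a : ℝ, ((d : ℝ) - 3) / ((d : ℝ) ^ 2 - d - 2) < a → a ≤ 1 / ((d : ℝ) + 2) →
        rho d a a ∈ InvSSbar d ∧ IsState (rho d a a) ∧
          LocalUnitaryEquiv (rho d a a) (partialTranspose (rho d a a)) ∧
          schmidtNumber (rho d a a) = d / 2)) := by
  have h0 : d ≠ 0 := by omega
  have hd4 : (4 : ℝ) ≤ d := by exact_mod_cast hd
  obtain ⟨a, ha⟩ : ∃ a : ℝ, a = 1 / (2 * d - 2) := ⟨_, rfl⟩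
  obtain ⟨b, hb⟩ : ∃ b : ℝ, b = (2 * d - 3) / (2 * d ^ 2 - 2) := ⟨_, rfl⟩
  obtain ⟨m1, m2, s1, s2⟩ := gap_values hd2 hd ha hb
  have hΓ := partialTranspose_rho hd2 a b
  have hΓ' := partialTranspose_sig hd2 a b
  have hrho : rho d a b ∈ InvSSbar d ∧ IsPPT (rho d a b) ∧
      schmidtNumber (rho d a b) = d / 2 ∧ schmidtNumber (partialTranspose (rho d a b)) = 2 := by
    refine ⟨rho_mem_InvSSbar hd2 h0 a b,
      ⟨isState_of_mem_schmidtSet (rho_mem_schmidtSet hd2 h0 m1), ?_⟩, ?_, ?_⟩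
    · rw [hΓ]; exact (isState_of_mem_schmidtSet m2).1
    · rw [schmidtNumber_rho hd2 h0, s1]
    · rw [hΓ, s2]
  have hself (a : ℝ) (ha : ((d : ℝ) - 3) / ((d : ℝ) ^ 2 - d - 2) < a)
      (ha' : a ≤ 1 / ((d : ℝ) + 2)) : rho d a a ∈ InvSSbar d ∧ IsState (rho d a a) ∧
      LocalUnitaryEquiv (rho d a a) (partialTranspose (rho d a a)) ∧
      schmidtNumber (rho d a a) = d / 2 := by
    refine ⟨rho_mem_InvSSbar hd2 h0 a a, isState_of_mem_schmidtSet
      (rho_mem_schmidtSet hd2 h0 (sig_self_mem_schmidtSet hd2 hd ha ha')), ?_, ?_⟩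
    · rw [partialTranspose_rho hd2]
      exact (localUnitaryEquiv_sig_rho hd2 h0 a a).symm
    · rw [schmidtNumber_rho hd2 h0, schmidtNumber_sig_self hd2 hd ha ha']
  -- The interval for $a$ is nonempty, as $(d-3)(d+2)<d^2-d-2$; its closed endpoint $1/(d+2)$ serves
  -- as the existence witness in both classes.
  have hg : ((d : ℝ) - 3) / ((d : ℝ) ^ 2 - d - 2) < 1 / ((d : ℝ) + 2) := by
    rw [div_lt_div_iff₀ (by nlinarith) (by positivity)]
    linarith
  refine ⟨⟨⟨_, hrho.1, hrho.2.1, ?_⟩, ⟨sig d a b, sig_mem_InvSS hd2 a b,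
    ⟨isState_of_mem_schmidtSet m1, ?_⟩, ?_⟩, ?_⟩, ⟨_, hself _ hg le_rfl⟩,
    ⟨sig d (1 / (d + 2)) (1 / (d + 2)), sig_mem_InvSS hd2 _ _, isState_of_mem_schmidtSet
      (sig_self_mem_schmidtSet hd2 hd hg le_rfl), ?_, schmidtNumber_sig_self hd2 hd hg le_rfl⟩,
    hself⟩
  · rw [hrho.2.2.1, hrho.2.2.2]; push_cast; rfl
  · rw [hΓ']
    exact (isState_of_mem_schmidtSet (rho_mem_schmidtSet hd2 h0 m2)).1
  · rw [hΓ', schmidtNumber_rho hd2 h0, s1, s2]; push_cast; rfl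
  · rintro ρ rfl
    rw [← ha, ← hb]
    exact hrho
  · rw [partialTranspose_sig hd2]
    exact localUnitaryEquiv_sig_rho hd2 h0 _ _
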